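/- Let $p$ be a prime. Let $(R,\mathfrak m,k)$ be a noetherian local ring of characteristic $p$ that is $F$-finite (its Frobenius is finite), let $K$ be the total ring of fractions of $R$, and let $(R,\mathfrak m,k)\subset(S,\mathfrak n,l)$ be a finite local extension with corresponding morphism $f\colon \operatorname{Spec}S\to\operatorname{Spec}R$. Put $L=K\otimes_RS$ and assume that $f$ is generically flat, i.e. $L$ is flat over $K$; $[L:K]$ denotes the rank of $L$ over $K$. *Cartier algebras and modules.* A Cartier $R$-algebra is an $\mathbb N$-graded ring $\mathcal C=\bigoplus_e\mathcal C_e$ with $\mathcal C_0=R$ and $r\kappa=\kappa r^{p^e}$ for $r\in R$, $\kappa\in\mathcal C_e$. A Cartier $\mathcal C$-module is a left $\mathcal C$-module $M$ that is finite over $R$; each $\kappa\in\mathcal C_e$ then acts by an $R$-linear map $F^e_*M\to M$. The Cartier $S$-algebra $f^*\mathcal C$ is $\bigoplus_e\mathcal C_e\otimes_RS$ with $(\kappa\otimes s)(\kappa'\otimes s')=\kappa\kappa'\otimes s^{p^d}s'$ for $\kappa'\in\mathcal C_d$. *Transposability.* Let $\omega_{S/R}=\operatorname{Hom}_R(S,R)$,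 an $S$-module through $(s\mu)(t)=\mu(st)$. Let $\sigma\colon S\to\omega_{S/R}$ be an injective $S$-linear map and put $T=\sigma(1)$. For an $R$-linear $\varphi\colon F^e_*R\to R$ define $\varphi^!\colon F^e_*\omega_{S/R}\to\omega_{S/R}$ by $\varphi^!(\mu)(s)=\varphi(\mu(s^{p^e}))$; a $T$-transpose of $\varphi$ is an $S$-linear map $\varphi^\top\colon F^e_*S\to S$ with $\sigma\circ\varphi^\top=\varphi^!\circ F^e_*\sigma$ (it is unique). If $R$ is a Cartier $\mathcal C$-module, it is called $T$-transposable if every homogeneous $\kappa\in\mathcal C$ acts on $R$ by a map that has a $T$-transpose $\kappa^\top$; then $S$ is a Cartier $f^*\mathcal C$-module through $(\kappa\otimes s)\cdot t=\kappa^\top(st)$. *$F$-signature.* For a local ring $(R,\mathfrak m,k)$ as above that is a Cartier $\mathcal C$-module let $a_e(R,\mathcal C)$ be the length of the left $R$-module $\mathcal C_e/\{\kappa\in\mathcal C_e\mid\kappa R\subset\mathfrak m\}$, let $n=\gcd\{e\mid a_e(R,\mathcal C)\ne0\}$ and $\delta=\dim R+\log_p[k^{1/p}:k]$. The $F$-signature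 is $s(R,\mathcal C)=\lim_{e\to\infty}a_{en}(R,\mathcal C)/p^{en\delta}$; it is $0$ by convention if $a_e(R,\mathcal C)=0$ for all $e>0$. *$F$-regularity.* Put $\mathcal C_+=\bigoplus_{e\ge1}\mathcal C_e$. The test module $\tau(M,\mathcal C)$ of a Cartier $\mathcal C$-module $M$ is the smallest Cartier submodule $N\subset M$ such that for every associated prime $\eta$ of $M$ some power of $(\mathcal C_\eta)_+$, where $\mathcal C_\eta=\mathcal C\otimes_RR_\eta$, maps $H^0_\eta(M_\eta)$ into $H^0_\eta(N_\eta)$; here $H^0_\eta$ denotes the submodule of elements killed by a power of $\eta$. The pair $(M,\mathcal C)$ is $F$-regular if $\tau(M,\mathcal C)=M$. **Theorem.** Let $\mathcal C$ be a Cartier $R$-algebra and let $R$ be a Cartier $\mathcal C$-module. Suppose that $\sigma\colon S\to\omega_{S/R}$ is an injective $S$-linear map that is a generic isomorphism (i.e. $K\otimes_R\sigma$ is bijective), that $T=\sigma(1)\colon S\to R$ is surjective, and that $T(\mathfrak n)\subset\mathfrak m$. If $R$ is a $T$-transposable Cartier $\mathcal C$-module, then the $F$-signatures $s(R,\mathcal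 C)$ and $s(S,f^*\mathcal C)$ exist and $$[l:k]\cdot s(S,f^*\mathcal C)=[L:K]\cdot s(R,\mathcal C).$$ Moreover, $(R,\mathcal C)$ is $F$-regular if and only if $(S,f^*\mathcal C)$ is $F$-regular. -/

import Mathlib

open scoped TensorProduct


universe u v w w'

noncomputable section

/-! ### Cartier algebras and Cartier modules

Throughout `p` is a prime number and rings have characteristic `p`; in degree `e` the letter `q`
stands for `p ^ e`. -/

/-- A Cartier `R`-algebra: an `ℕ`-graded ring `⨁ₑ 𝒞ₑ` with `𝒞₀ = R` (via `coeff`) and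
`r κ = κ r^q` for `r ∈ R`, `κ ∈ 𝒞ₑ`. The graded ring is given by its homogeneous components and the
products `𝒞ₑ × 𝒞_d → 𝒞ₙ`, `e + d = n`; the two `R`-module structures of `𝒞ₑ` are left and right
multiplication by `𝒞₀ = R`. -/
structure CartierAlgebra (p : ℕ) (R : Type u) [CommRing R] where
  deg : ℕ → Type w
  [grp : ∀ e, AddCommGroup (deg e)]
  mul : ∀ {e d n : ℕ}, e + d = n → deg e →+ deg d →+ deg n
  mul_assoc : ∀ {a b c ab bc n : ℕ} (hab : a + b = ab) (hbc : b + c = bc) (h₁ : ab + c = n)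
    (h₂ : a + bc = n) (x : deg a) (y : deg b) (z : deg c),
    mul h₁ (mul hab x y) z = mul h₂ x (mul hbc y z)
  coeff : R ≃+ deg 0
  coeff_mul : ∀ r s : R, coeff (r * s) = mul (zero_add 0) (coeff r) (coeff s)
  one_mul : ∀ {e : ℕ} (x : deg e), mul (zero_add e) (coeff 1) x = x
  mul_one : ∀ {e : ℕ} (x : deg e), mul (add_zero e) x (coeff 1) = x
  coeff_mul_comm : ∀ {e : ℕ} (r : R) (x : deg e),
    mul (zero_add e) (coeff r) x = mul (add_zero e) x (coeff (r ^ p ^ e))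

namespace CartierAlgebra

attribute [instance] CartierAlgebra.grp

variable {p : ℕ} {R : Type u} [CommRing R] (C : CartierAlgebra.{u, w} p R)

/-- The right `R`-module structure of `𝒞ₑ` (`R` is commutative, so it is written on the left):
`r • κ = κ r`. -/
instance rightModule (e : ℕ) : Module R (C.deg e) where
  smul r x := C.mul (add_zero e) x (C.coeff r)
  one_smul x := C.mul_one x
  mul_smul r s x := by
    change C.mul _ x (C.coeff (r * s)) = C.mul _ (C.mul _ x (C.coeff s)) (C.coeff r)
    rw [mul_comm, C.coeff_mul]
    exact (C.mul_assoc _ _ _ _ _ _ _).symm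
  smul_zero r := by
    change C.mul _ 0 (C.coeff r) = 0
    rw [map_zero, AddMonoidHom.zero_apply]
  smul_add r x y := by
    change C.mul _ (x + y) (C.coeff r) = C.mul _ x (C.coeff r) + C.mul _ y (C.coeff r)
    rw [map_add, AddMonoidHom.add_apply]
  add_smul r s x := by
    change C.mul _ x (C.coeff (r + s)) = C.mul _ x (C.coeff r) + C.mul _ x (C.coeff s)
    rw [map_add, map_add]
  zero_smul x := by
    change C.mul _ x (C.coeff 0) = 0
    rw [map_zero, map_zero]

theorem right_smul_def {e : ℕ} (r : R) (x : C.deg e) :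
    r • x = C.mul (add_zero e) x (C.coeff r) := rfl

/-- A copy of `𝒞ₑ`, regarded as a left `R`-module. -/
structure LDeg (e : ℕ) : Type w where
  /-- the underlying element of `𝒞ₑ` -/
  val : C.deg e

/-- `LDeg e` has the same elements as `𝒞ₑ`. -/
def lequiv (e : ℕ) : C.LDeg e ≃ C.deg e := ⟨LDeg.val, LDeg.mk, fun _ => rfl, fun _ => rfl⟩

instance (e : ℕ) : AddCommGroup (C.LDeg e) := (C.lequiv e).addCommGroup

/-- The left `R`-module structure of `𝒞ₑ`. -/
instance leftModule (e : ℕ) : Module R (C.LDeg e) where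
  smul r x := ⟨C.mul (zero_add e) (C.coeff r) x.val⟩
  one_smul x := congrArg LDeg.mk (C.one_mul x.val)
  mul_smul r s x := congrArg LDeg.mk <| by
    change C.mul _ (C.coeff (r * s)) x.val = C.mul _ (C.coeff r) (C.mul _ (C.coeff s) x.val)
    rw [C.coeff_mul, C.mul_assoc]
  smul_zero r := congrArg LDeg.mk (map_zero _)
  smul_add r x y := congrArg LDeg.mk (map_add _ x.val y.val)
  add_smul r s x := congrArg LDeg.mk <| by
    change C.mul _ (C.coeff (r + s)) x.val =
      C.mul _ (C.coeff r) x.val + C.mul _ (C.coeff s) x.val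
    rw [map_add, map_add, AddMonoidHom.add_apply]
  zero_smul x := congrArg LDeg.mk <| by
    change C.mul _ (C.coeff 0) x.val = 0
    rw [map_zero, map_zero, AddMonoidHom.zero_apply]

/-- Multiplication `𝒞_d → 𝒞ₙ` by a fixed element on the left is right `R`-linear. -/
def mulLeft {e d n : ℕ} (h : e + d = n) (x : C.deg e) : C.deg d →ₗ[R] C.deg n where
  toFun y := C.mul h x y
  map_add' y z := map_add (C.mul h x) y z
  map_smul' r y := (C.mul_assoc h (add_zero d) (add_zero n) h x y (C.coeff r)).symm

end CartierAlgebra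

/-- A Cartier `𝒞`-module structure on the `R`-module `M`, i.e. a left module structure over the
graded ring `𝒞` extending the `R`-module structure. -/
structure CartierModule {p : ℕ} {R : Type u} [CommRing R] (C : CartierAlgebra.{u, w} p R)
    (M : Type v) [AddCommGroup M] [Module R M] where
  act : ∀ e : ℕ, C.deg e →+ (M →+ M)
  act_mul : ∀ {e d n : ℕ} (h : e + d = n) (x : C.deg e) (y : C.deg d) (m : M),
    act n (C.mul h x y) m = act e x (act d y m)
  act_coeff : ∀ (r : R) (m : M), act 0 (C.coeff r) m = r • m

/-- `φ` is an `R`-linear map `Fᵉ_* M → M`. -/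
def IsCartierLinear (p : ℕ) (R : Type u) [CommRing R] {M : Type v} [AddCommGroup M] [Module R M]
    (e : ℕ) (φ : M →+ M) : Prop :=
  ∀ (r : R) (m : M), φ (r ^ p ^ e • m) = r • φ m

theorem CartierModule.act_right {p : ℕ} {R : Type u} [CommRing R] {C : CartierAlgebra.{u, w} p R}
    {M : Type v} [AddCommGroup M] [Module R M] (ρ : CartierModule C M) {e : ℕ} (x)
    (r : R) (m : M) : ρ.act e (r • x) m = ρ.act e x (r • m) := by
  rw [← ρ.act_coeff r m]
  exact ρ.act_mul (add_zero e) x (C.coeff r) m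

theorem CartierModule.isCartierLinear {p : ℕ} {R : Type u} [CommRing R]
    {C : CartierAlgebra.{u, w} p R} {M : Type v} [AddCommGroup M] [Module R M]
    (ρ : CartierModule C M) {e : ℕ} (x : C.deg e) : IsCartierLinear p R e (ρ.act e x) := by
  intro r m
  rw [← ρ.act_coeff (r ^ p ^ e) m, ← ρ.act_mul (add_zero e), ← C.coeff_mul_comm, ρ.act_mul,
    ρ.act_coeff]

/-! ### The Cartier algebra `f^* 𝒞` -/

theorem frobPow_add (p : ℕ) [hp : Fact p.Prime] (R : Type u) [CommRing R] [CharP R p] {S : Type v}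
    [CommRing S] [Algebra R S] (e : ℕ) (a b : S) : (a + b) ^ p ^ e = a ^ p ^ e + b ^ p ^ e := by
  rcases subsingleton_or_nontrivial S with h | h
  · exact Subsingleton.elim _ _
  · have h0 : (p : S) = 0 := by
      rw [← map_natCast (algebraMap R S), CharP.cast_eq_zero, map_zero]
    have : CharP S p := (CharP.charP_iff_prime_eq_zero hp.out).2 h0
    exact add_pow_char_pow a b p e

section Pullback

variable {p : ℕ} [Fact p.Prime] {R : Type u} [CommRing R] [CharP R p]
  (C : CartierAlgebra.{u, w} p R) (S : Type v) [CommRing S] [Algebra R S]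

/-- The product of `f^* 𝒞`: `(κ ⊗ s) (κ' ⊗ s') = κ κ' ⊗ s^(p^d) s'` if `κ'` has degree `d`. -/
def CartierAlgebra.pullbackMul {e d n : ℕ} (h : e + d = n) :
    (C.deg e ⊗[R] S) →+ (C.deg d ⊗[R] S) →+ (C.deg n ⊗[R] S) :=
  TensorProduct.liftAddHom
    { toFun := fun x =>
        { toFun := fun s =>
            (TensorProduct.map (C.mulLeft h x)
              (LinearMap.mulLeft R (s ^ p ^ d))).toAddMonoidHom
          map_zero' := by
            rw [zero_pow (pow_ne_zero d (Fact.out : p.Prime).ne_zero), LinearMap.mulLeft_zero_eq_zero,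
              TensorProduct.map_zero_right]
            rfl
          map_add' := fun s t => by
            have : LinearMap.mulLeft R ((s + t) ^ p ^ d) =
                LinearMap.mulLeft R (s ^ p ^ d) + LinearMap.mulLeft R (t ^ p ^ d) := by
              ext; simp [frobPow_add p R, add_mul]
            rw [this, TensorProduct.map_add_right]
            rfl }
      map_zero' := by
        ext1 s
        have : C.mulLeft h 0 = 0 := by
          ext y
          change C.mul h 0 y = 0
          rw [map_zero, AddMonoidHom.zero_apply]
        change (TensorProduct.map (C.mulLeft h 0) _).toAddMonoidHom = _
        rw [this, TensorProduct.map_zero_left]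
        rfl
      map_add' := fun x x' => by
        ext1 s
        have : C.mulLeft h (x + x') = C.mulLeft h x + C.mulLeft h x' := by
          ext y
          change C.mul h (x + x') y = C.mul h x y + C.mul h x' y
          rw [map_add, AddMonoidHom.add_apply]
        change (TensorProduct.map (C.mulLeft h (x + x')) _).toAddMonoidHom = _
        rw [this, TensorProduct.map_add_left]
        rfl }
    (by
      intro r x s
      change (TensorProduct.map (C.mulLeft h (r • x)) (LinearMap.mulLeft R (s ^ p ^ d))).toAddMonoidHom
        = (TensorProduct.map (C.mulLeft h x) (LinearMap.mulLeft R ((r • s) ^ p ^ d))).toAddMonoidHom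
      have h₁ : C.mulLeft h (r • x) = r ^ p ^ d • C.mulLeft h x := by
        ext y
        change C.mul h (C.mul _ x (C.coeff r)) y = C.mul _ (C.mul h x y) (C.coeff (r ^ p ^ d))
        rw [C.mul_assoc _ (zero_add d) _ h, C.coeff_mul_comm, C.mul_assoc h (add_zero d) _ h]
      have h₂ : LinearMap.mulLeft R ((r • s) ^ p ^ d) =
          r ^ p ^ d • LinearMap.mulLeft R (s ^ p ^ d) := by
        ext; simp [smul_pow]
      rw [h₁, h₂, TensorProduct.map_smul_left, TensorProduct.map_smul_right])

theorem CartierAlgebra.pullbackMul_tmul {e d n : ℕ} (h : e + d = n) (x : C.deg e) (s : S)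
    (y : C.deg d) (t : S) :
    C.pullbackMul S h ((x) ⊗ₜ[R] s) ((y) ⊗ₜ[R] t) =
      (C.mul h x y) ⊗ₜ[R] (s ^ p ^ d * t) := rfl

/-- The identification of `S` with the degree-zero part `𝒞₀ ⊗_R S` of `f^* 𝒞`. -/
def CartierAlgebra.pullbackCoeff : S ≃+ (C.deg 0 ⊗[R] S) :=
  ((TensorProduct.lid R S).symm.trans
    (TensorProduct.congr
      ({ C.coeff with
          map_smul' := fun r s => by
            change C.coeff (r * s) = C.mul _ (C.coeff s) (C.coeff r)
            rw [mul_comm, C.coeff_mul] } : R ≃ₗ[R] C.deg 0)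
      (LinearEquiv.refl R S))).toAddEquiv

theorem CartierAlgebra.pullbackCoeff_apply (s : S) :
    C.pullbackCoeff S s = (C.coeff 1) ⊗ₜ[R] s := rfl

/-- The Cartier `S`-algebra `f^* 𝒞 = 𝒞 ⊗_R S`. -/
def CartierAlgebra.pullback : CartierAlgebra.{v, max w v} p S where
  deg e := C.deg e ⊗[R] S
  mul h := C.pullbackMul S h
  mul_assoc {a b c ab bc n} hab hbc h₁ h₂ x y z := by
    induction x using TensorProduct.induction_on with
    | zero => simp
    | add x x' hx hx' => simp only [map_add, AddMonoidHom.add_apply, hx, hx']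
    | tmul x s =>
      induction y using TensorProduct.induction_on with
      | zero => simp
      | add y y' hy hy' => simp only [map_add, AddMonoidHom.add_apply, hy, hy']
      | tmul y t =>
        induction z using TensorProduct.induction_on with
        | zero => simp
        | add z z' hz hz' => simp only [map_add, hz, hz']
        | tmul z r =>
          rw [C.pullbackMul_tmul, C.pullbackMul_tmul, C.pullbackMul_tmul, C.pullbackMul_tmul,
            C.mul_assoc hab hbc h₁ h₂]
          congr 1
          rw [← hbc, mul_pow, pow_add, pow_mul, _root_.mul_assoc]
  coeff := C.pullbackCoeff S
  coeff_mul r s := by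
    rw [C.pullbackCoeff_apply, C.pullbackCoeff_apply, C.pullbackCoeff_apply,
      C.pullbackMul_tmul, C.one_mul, pow_zero, pow_one]
  one_mul {e} x := by
    rw [C.pullbackCoeff_apply]
    induction x using TensorProduct.induction_on with
    | zero => simp
    | add y y' hy hy' => simp only [map_add, hy, hy']
    | tmul y t => rw [C.pullbackMul_tmul, C.one_mul, one_pow, _root_.one_mul]
  mul_one {e} x := by
    rw [C.pullbackCoeff_apply]
    induction x using TensorProduct.induction_on with
    | zero => simp
    | add y y' hy hy' => simp only [map_add, AddMonoidHom.add_apply, hy, hy']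
    | tmul y t => rw [C.pullbackMul_tmul, C.mul_one, pow_zero, pow_one, _root_.mul_one]
  coeff_mul_comm {e} r x := by
    rw [C.pullbackCoeff_apply, C.pullbackCoeff_apply]
    induction x using TensorProduct.induction_on with
    | zero => simp
    | add y y' hy hy' => simp only [map_add, AddMonoidHom.add_apply, hy, hy']
    | tmul y t =>
      rw [C.pullbackMul_tmul, C.pullbackMul_tmul, C.one_mul, C.mul_one, pow_zero, pow_one, mul_comm]

variable {S} {N : Type w'} [AddCommGroup N] [Module S N]

/-- The action `(κ ⊗ s) n = a κ (s n)` of `𝒞ₑ ⊗_R S` on an `S`-module `N`. -/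
def pullbackAct {e : ℕ} (a : C.deg e →+ (N →+ N))
    (ha : ∀ (r : R) (x : C.deg e) (m : N), a (r • x) m = a x (algebraMap R S r • m)) :
    (C.deg e ⊗[R] S) →+ (N →+ N) :=
  TensorProduct.liftAddHom
    { toFun := fun x =>
        { toFun := fun s => (a x).comp (DistribSMul.toAddMonoidHom N s)
          map_zero' := by ext t; simp
          map_add' := fun s s' => by ext t; simp [add_smul] }
      map_zero' := by ext s t; simp
      map_add' := fun x x' => by ext s t; simp }
    (by
      intro r x s
      ext t
      change a (r • x) (s • t) = a x ((r • s) • t)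
      rw [ha, Algebra.smul_def, mul_smul])

theorem pullbackAct_tmul {e : ℕ} (a : C.deg e →+ (N →+ N))
    (ha : ∀ (r : R) (x : C.deg e) (m : N), a (r • x) m = a x (algebraMap R S r • m))
    (x : C.deg e) (s : S) (m : N) : pullbackAct C a ha (x ⊗ₜ[R] s) m = a x (s • m) := rfl

/-- A family of `S`-linear maps `a κ : Fᵉ_* N → N`, `κ ∈ 𝒞ₑ`, that is additive and multiplicative in
`κ` and compatible with `𝒞₀ = R`, makes the `S`-module `N` a Cartier `f^* 𝒞`-module through
`(κ ⊗ s) n = a κ (s n)`. -/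
def CartierModule.ofPullback (a : ∀ e : ℕ, C.deg e →+ (N →+ N))
    (ha_lin : ∀ (e : ℕ) (x : C.deg e), IsCartierLinear p S e (a e x))
    (ha_mul : ∀ {e d n : ℕ} (h : e + d = n) (x : C.deg e) (y : C.deg d) (m : N),
      a n (C.mul h x y) m = a e x (a d y m))
    (ha_coeff : ∀ (r : R) (m : N), a 0 (C.coeff r) m = algebraMap R S r • m) :
    CartierModule (C.pullback S) N where
  act e := pullbackAct C (a e) fun r x m => by rw [C.right_smul_def, ha_mul, ha_coeff]
  act_mul {e d n} h x y t := by
    have key : ∀ (x : C.deg e ⊗[R] S) (y : C.deg d ⊗[R] S),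
        pullbackAct C (a n) (fun r x m => by rw [C.right_smul_def, ha_mul, ha_coeff])
          (C.pullbackMul S h x y) t =
        pullbackAct C (a e) (fun r x m => by rw [C.right_smul_def, ha_mul, ha_coeff]) x
          (pullbackAct C (a d) (fun r x m => by rw [C.right_smul_def, ha_mul, ha_coeff]) y t) := by
      intro x y
      induction x using TensorProduct.induction_on with
      | zero => simp only [map_zero, AddMonoidHom.zero_apply]
      | add x x' hx hx' => simp only [map_add, AddMonoidHom.add_apply, hx, hx']
      | tmul x s =>
        induction y using TensorProduct.induction_on with
        | zero => simp only [map_zero, AddMonoidHom.zero_apply]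
        | add y y' hy hy' => simp only [map_add, AddMonoidHom.add_apply, hy, hy']
        | tmul y s' =>
          rw [C.pullbackMul_tmul, pullbackAct_tmul, pullbackAct_tmul, pullbackAct_tmul, ha_mul,
            mul_smul, ha_lin]
    exact key x y
  act_coeff s t := by
    change a 0 (C.coeff 1) (s • t) = s • t
    rw [ha_coeff, map_one, one_smul]

end Pullback

/-! ### The functor `f^!` -/

section Shriek

variable (R : Type u) [CommRing R] (S : Type v) [CommRing S] [Algebra R S]
  (M : Type w') [AddCommGroup M] [Module R M]

/-- `f^! M = Hom_R(S, M)`; in particular `f^! R = ω_{S/R}`. -/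
def UpperShriek : Type _ := S →ₗ[R] M

instance : AddCommGroup (UpperShriek R S M) := inferInstanceAs (AddCommGroup (S →ₗ[R] M))

instance : Module R (UpperShriek R S M) := inferInstanceAs (Module R (S →ₗ[R] M))

instance : FunLike (UpperShriek R S M) S M := inferInstanceAs (FunLike (S →ₗ[R] M) S M)

instance : LinearMapClass (UpperShriek R S M) R S M :=
  inferInstanceAs (LinearMapClass (S →ₗ[R] M) R S M)

variable {R S M}

@[ext] theorem UpperShriek.ext {μ ν : UpperShriek R S M} (h : ∀ s, μ s = ν s) : μ = ν :=
  LinearMap.ext h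

/-- The `S`-module structure of `f^! M` by premultiplication: `(s • μ)(t) = μ(s t)`. -/
instance : Module S (UpperShriek R S M) where
  smul s μ := LinearMap.comp (R₁ := R) (show S →ₗ[R] M from μ) (LinearMap.mulLeft R s)
  one_smul μ := UpperShriek.ext fun t => congrArg μ (one_mul t)
  mul_smul s s' μ := UpperShriek.ext fun t => congrArg μ (by
    change s * s' * t = s' * (s * t); ring)
  smul_zero s := rfl
  smul_add s μ ν := rfl
  add_smul s s' μ := UpperShriek.ext fun t => by
    change μ ((s + s') * t) = μ (s * t) + μ (s' * t)
    rw [add_mul, map_add]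
  zero_smul μ := UpperShriek.ext fun t => by
    change μ (0 * t) = 0
    rw [zero_mul, map_zero]

theorem UpperShriek.smul_apply (s : S) (μ : UpperShriek R S M) (t : S) : (s • μ) t = μ (s * t) :=
  rfl

instance : IsScalarTower R S (UpperShriek R S M) where
  smul_assoc r s μ := UpperShriek.ext fun t => by
    change μ ((r • s) * t) = r • μ (s * t)
    rw [smul_mul_assoc, map_smul]

/-- For an `R`-linear `φ : Fᵉ_* M → M` the map `φ^! : Fᵉ_* f^! M → f^! M`,
`φ^!(μ)(s) = φ(μ(s^q))`. -/
def shriekMap {p : ℕ} [Fact p.Prime] [CharP R p] {e : ℕ} {φ : M →+ M}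
    (hφ : IsCartierLinear p R e φ) : UpperShriek R S M →+ UpperShriek R S M where
  toFun μ :=
    { toFun := fun s => φ (μ (s ^ p ^ e))
      map_add' := fun s t => by rw [frobPow_add p R, map_add, map_add]
      map_smul' := fun r s => by
        rw [smul_pow, map_smul, hφ]; rfl }
  map_zero' := UpperShriek.ext fun s => map_zero φ
  map_add' μ ν := UpperShriek.ext fun s => map_add φ _ _

/-! ### Transposability along a section `σ : S → ω_{S/R}` -/

variable {p : ℕ} [Fact p.Prime] [CharP R p] {C : CartierAlgebra.{u, w} p R}

/-- `ψ : Fᵉ_* S → S` is a `T`-transpose of `φ : Fᵉ_* R → R`, where `T = σ(1)`: it is `S`-linear and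
`σ ∘ ψ = φ^! ∘ Fᵉ_* σ`. -/
def IsTranspose (σ : S →ₗ[S] UpperShriek R S R) {e : ℕ} {φ : R →+ R}
    (hφ : IsCartierLinear p R e φ) (ψ : S →+ S) : Prop :=
  IsCartierLinear p S e ψ ∧ ∀ s : S, σ (ψ s) = shriekMap hφ (σ s)

/-- `R` is a `T`-transposable Cartier `𝒞`-module: every homogeneous element of `𝒞` acts on `R` by a
map that has a `T`-transpose. -/
def IsTransposable (σ : S →ₗ[S] UpperShriek R S R) (ρ : CartierModule C R) : Prop :=
  ∀ (e : ℕ) (x : C.deg e), ∃ ψ : S →+ S, IsTranspose σ (ρ.isCartierLinear x) ψ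

variable {σ : S →ₗ[S] UpperShriek R S R} {ρ : CartierModule C R}

/-- The `T`-transpose of (the action of) `κ ∈ 𝒞ₑ`; it is unique if `σ` is injective. -/
def transpose (hT : IsTransposable σ ρ) {e : ℕ} (x : C.deg e) : S →+ S := (hT e x).choose

theorem transpose_linear (hT : IsTransposable σ ρ) {e : ℕ} (x : C.deg e) :
    IsCartierLinear p S e (transpose hT x) := (hT e x).choose_spec.1

theorem transpose_spec (hT : IsTransposable σ ρ) {e : ℕ} (x : C.deg e) (s t : S) :
    σ (transpose hT x s) t = ρ.act e x (σ s (t ^ p ^ e)) :=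
  congrArg (fun μ : UpperShriek R S R => μ t) ((hT e x).choose_spec.2 s)

/-- The Cartier `f^* 𝒞`-module structure of `S` given by `κ ⊗ s ↦ κ^⊤ · s`, that is,
`(κ ⊗ s) t = κ^⊤(s t)`. -/
def transposeModule (hσ : Function.Injective σ) (hT : IsTransposable σ ρ) :
    CartierModule (C.pullback S) S :=
  CartierModule.ofPullback C
    (fun e =>
      { toFun := fun x => transpose hT x
        map_zero' := by
          ext s
          apply hσ
          ext t
          rw [transpose_spec, map_zero, AddMonoidHom.zero_apply, AddMonoidHom.zero_apply, map_zero]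
          rfl
        map_add' := fun x y => by
          ext s
          apply hσ
          ext t
          rw [transpose_spec, map_add, AddMonoidHom.add_apply, AddMonoidHom.add_apply, map_add,
            ← transpose_spec hT, ← transpose_spec hT]
          rfl })
    (fun e x => transpose_linear hT x)
    (fun {e d n} h x y s => by
      apply hσ
      ext t
      change σ (transpose hT (C.mul h x y) s) t = σ (transpose hT x (transpose hT y s)) t
      rw [transpose_spec, transpose_spec, transpose_spec, ρ.act_mul, ← pow_mul, ← pow_add, h])
    (fun r s => by
      apply hσ
      ext t
      change σ (transpose hT (C.coeff r) s) t = _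
      rw [transpose_spec, ρ.act_coeff, pow_zero, pow_one, map_smul, UpperShriek.smul_apply,
        ← Algebra.smul_def, map_smul])

end Shriek

/-! ### Test modules and `F`-regularity -/

namespace CartierModule

variable {p : ℕ} {R : Type u} [CommRing R] {C : CartierAlgebra.{u, w} p R}
  {M : Type v} [AddCommGroup M] [Module R M] (ρ : CartierModule C M)

/-- The action of `κ ∈ 𝒞ₑ` on `W⁻¹ M`: `κ (m / u) = κ (u^(q-1) m) / u`. -/
def locAct (W : Submonoid R) (e : ℕ) (hq : p ^ e ≠ 0) (x : C.deg e) :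
    LocalizedModule W M →+ LocalizedModule W M where
  toFun y := y.liftOn (fun a => LocalizedModule.mk (ρ.act e x ((a.2 : R) ^ (p ^ e - 1) • a.1)) a.2)
    (by
      rintro ⟨m, u⟩ ⟨m', u'⟩ ⟨c, hc⟩
      have hs : ∀ a : R, a ^ p ^ e = a ^ (p ^ e - 1) * a := fun a => by
        rw [← pow_succ, Nat.sub_add_cancel (Nat.pos_of_ne_zero hq)]
      simp only [Submonoid.smul_def] at hc
      refine LocalizedModule.mk_eq.2 ⟨c, ?_⟩
      simp only [Submonoid.smul_def]
      rw [← ρ.isCartierLinear, ← ρ.isCartierLinear, ← ρ.isCartierLinear, ← ρ.isCartierLinear]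
      congr 1
      rw [hs, hs, hs]
      have := congrArg (fun z => ((c : R) ^ (p ^ e - 1) * (u : R) ^ (p ^ e - 1) *
        (u' : R) ^ (p ^ e - 1)) • z) hc
      simp only [smul_smul] at this ⊢
      convert this using 2 <;> ring)
  map_zero' := by
    rw [← LocalizedModule.zero_mk (1 : W), LocalizedModule.liftOn_mk]
    simp
  map_add' y z := by
    induction y using LocalizedModule.induction_on with
    | h m u =>
    induction z using LocalizedModule.induction_on with
    | h m' u' =>
    have hs : ∀ a : R, a ^ p ^ e = a ^ (p ^ e - 1) * a := fun a => by
      rw [← pow_succ, Nat.sub_add_cancel (Nat.pos_of_ne_zero hq)]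
    rw [LocalizedModule.mk_add_mk, LocalizedModule.liftOn_mk, LocalizedModule.liftOn_mk,
      LocalizedModule.liftOn_mk, LocalizedModule.mk_add_mk]
    congr 1
    simp only [Submonoid.smul_def, Submonoid.coe_mul]
    rw [← ρ.isCartierLinear, ← ρ.isCartierLinear, ← map_add, smul_add, hs, hs]
    congr 2
    · simp only [smul_smul]; congr 1; ring
    · simp only [smul_smul]; congr 1; ring

theorem locAct_mk (W : Submonoid R) (e : ℕ) (hq : p ^ e ≠ 0) (x : C.deg e) (m : M) (u : W) :
    ρ.locAct W e hq x (LocalizedModule.mk m u) =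
      LocalizedModule.mk (ρ.act e x ((u : R) ^ (p ^ e - 1) • m)) u := rfl

/-- The localization `W⁻¹ M` as a Cartier module over `W⁻¹ 𝒞 = 𝒞 ⊗_R W⁻¹ R`. -/
def localization [Fact p.Prime] [CharP R p] (W : Submonoid R) :
    CartierModule (C.pullback (Localization W)) (LocalizedModule W M) :=
  have hq : ∀ e, p ^ e ≠ 0 := fun e => pow_ne_zero e (Fact.out : p.Prime).ne_zero
  have hs : ∀ (e : ℕ) (a : R), a ^ p ^ e = a ^ (p ^ e - 1) * a := fun e a => by
    rw [← pow_succ, Nat.sub_add_cancel (Nat.pos_of_ne_zero (hq e))]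
  CartierModule.ofPullback C
    (fun e =>
      { toFun := fun x => ρ.locAct W e (hq e) x
        map_zero' := by
          ext y
          induction y using LocalizedModule.induction_on with
          | h m u => rw [locAct_mk, map_zero]; simp
        map_add' := fun x x' => by
          ext y
          induction y using LocalizedModule.induction_on with
          | h m u =>
            rw [AddMonoidHom.add_apply, locAct_mk, locAct_mk, locAct_mk, map_add,
              AddMonoidHom.add_apply, LocalizedModule.mk_add_mk, ← smul_add,
              LocalizedModule.mk_cancel_common_left] })
    (fun e x => by
      intro c y
      change ρ.locAct W e (hq e) x (c ^ p ^ e • y) = c • ρ.locAct W e (hq e) x y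
      induction y using LocalizedModule.induction_on with
      | h m u =>
        induction c using Localization.induction_on with
        | H c =>
          obtain ⟨r, v⟩ := c
          rw [Localization.mk_pow, LocalizedModule.mk_smul_mk, locAct_mk, locAct_mk, LocalizedModule.mk_smul_mk]
          refine LocalizedModule.mk_eq.2 ⟨1, ?_⟩
          simp only [one_smul, Submonoid.smul_def, Submonoid.coe_mul, SubmonoidClass.coe_pow]
          have hl := fun (a : R) (b : M) => (ρ.isCartierLinear x a b).symm
          simp only [hl, smul_smul]
          congr 2
          have h2 := hs e ((v : R) ^ p ^ e)
          rw [mul_pow, mul_pow, mul_pow, h2]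
          ring)
    (fun {e d n} h x y z => by
      change ρ.locAct W n (hq n) (C.mul h x y) z =
        ρ.locAct W e (hq e) x (ρ.locAct W d (hq d) y z)
      induction z using LocalizedModule.induction_on with
      | h m u =>
        rw [locAct_mk, locAct_mk, locAct_mk, ρ.act_mul, ← ρ.isCartierLinear y, smul_smul]
        congr 4
        have : p ^ n - 1 = (p ^ e - 1) * p ^ d + (p ^ d - 1) := by
          have h1 := Nat.pos_of_ne_zero (hq e)
          have h2 := Nat.pos_of_ne_zero (hq d)
          rw [← h, pow_add, Nat.sub_mul, one_mul]
          have : p ^ d ≤ p ^ e * p ^ d := Nat.le_mul_of_pos_left _ h1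
          omega
        rw [this, pow_add, pow_mul])
    (fun r z => by
      change ρ.locAct W 0 (hq 0) (C.coeff r) z = _
      induction z using LocalizedModule.induction_on with
      | h m u =>
        rw [locAct_mk, ρ.act_coeff, pow_zero, Nat.sub_self, pow_zero, one_smul, algebraMap_smul,
          LocalizedModule.smul'_mk])

/-- `N` is a Cartier submodule of `M`. -/
def IsCartierSubmodule (N : Submodule R M) : Prop :=
  ∀ (e : ℕ) (x : C.deg e), ∀ m ∈ N, ρ.act e x m ∈ N

/-- `ρ.PlusOrbit h m m'`: the element `m'` arises from `m` by applying `h` homogeneous elements of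
positive degree, one after the other. The additive span of all such `m'` is `(𝒞₊)ʰ m`. -/
inductive PlusOrbit : ℕ → M → M → Prop
  | zero (m : M) : PlusOrbit 0 m m
  | succ {h : ℕ} {m m' : M} {e : ℕ} (he : 0 < e) (x : C.deg e) :
      PlusOrbit h m m' → PlusOrbit (h + 1) m (ρ.act e x m')

/-- `ρ.NilInto N' N`: some power of `𝒞₊` maps `N'` into `N`; if `N ⊆ N'` are Cartier submodules, this
says that the inclusion `N → N'` is a nil-isomorphism. -/
def NilInto (N' N : Set M) : Prop :=
  ∃ h : ℕ, ∀ m ∈ N', ∀ m', ρ.PlusOrbit h m m' → m' ∈ N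

end CartierModule

/-- `H⁰_η(M_η)`, the elements of `M_η` killed by a power of the maximal ideal of `R_η`. -/
def localH0 {R : Type u} [CommRing R] (M : Type v) [AddCommGroup M] [Module R M] (η : Ideal R)
    [η.IsPrime] : Set (LocalizedModule η.primeCompl M) :=
  {y | ∃ k : ℕ, ∀ c ∈ IsLocalRing.maximalIdeal (Localization η.primeCompl) ^ k, c • y = 0}

namespace CartierModule

variable {p : ℕ} [Fact p.Prime] {R : Type u} [CommRing R] [CharP R p]
  {C : CartierAlgebra.{u, w} p R} {M : Type v} [AddCommGroup M] [Module R M]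
  (ρ : CartierModule C M)

/-- `N` is a Cartier submodule of `M` for which the inclusion `H⁰_η(N_η) → H⁰_η(M_η)` is a
nil-isomorphism for all associated primes `η` of `M`. Here `N_η ⊆ M_η`, and
`H⁰_η(N_η) = N_η ∩ H⁰_η(M_η)`. -/
def IsTestSubmodule (N : Submodule R M) : Prop :=
  ρ.IsCartierSubmodule N ∧
    ∀ (η : Ideal R) [η.IsPrime], η ∈ associatedPrimes R M →
      (ρ.localization η.primeCompl).NilInto (localH0 M η)
        ((N.localized η.primeCompl : Set (LocalizedModule η.primeCompl M)) ∩ localH0 M η)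

/-- The test module `τ(M, 𝒞)`, the smallest submodule as in `IsTestSubmodule`. -/
def testModule : Submodule R M := sInf {N | ρ.IsTestSubmodule N}

/-- `(M, 𝒞)` is `F`-regular if `τ(M, 𝒞) = M`. -/
def IsFRegular : Prop := ρ.testModule = ⊤

end CartierModule

/-! ### The `F`-signature -/

namespace CartierModule

variable {p : ℕ} {R : Type u} [CommRing R] [IsLocalRing R] {C : CartierAlgebra.{u, w} p R}
  (ρ : CartierModule C R)

/-- The left `R`-submodule `𝒞ₑ^ns` of all `κ ∈ 𝒞ₑ` with `κ R ⊆ 𝔪`. -/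
def nonSurj (e : ℕ) : Submodule R (C.LDeg e) where
  carrier := {x | ∀ r : R, ρ.act e x.val r ∈ IsLocalRing.maximalIdeal R}
  zero_mem' r := by
    change ρ.act e 0 r ∈ _
    rw [map_zero]; exact zero_mem _
  add_mem' {x y} hx hy r := by
    change ρ.act e (x.val + y.val) r ∈ _
    rw [map_add]; exact add_mem (hx r) (hy r)
  smul_mem' c x hx r := by
    change ρ.act e (C.mul (zero_add e) (C.coeff c) x.val) r ∈ _
    rw [ρ.act_mul, ρ.act_coeff]
    exact Submodule.smul_mem _ _ (hx r)

/-- The `e`-th splitting number `a_e(R, 𝒞)`, the length of the left `R`-module `𝒞ₑ / 𝒞ₑ^ns`. (This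
length is finite if `R` is `F`-finite.) -/
def splittingNumber (e : ℕ) : ℕ := (Module.length R (C.LDeg e ⧸ ρ.nonSurj e)).toNat

/-- The greatest common divisor of all `e` with `a_e(R, 𝒞) ≠ 0`. It is `0` if `a_e(R, 𝒞) = 0` for all
`e > 0`: then the set below is unbounded. -/
def splittingPeriod : ℕ := sSup {d : ℕ | ∀ e : ℕ, ρ.splittingNumber e ≠ 0 → d ∣ e}

end CartierModule

/-- `δ = dim R + log_p [k^{1/p} : k]`, where `k` is the residue field of `R`. The degree is computed
as `[k : k^p]`. -/
def fSigExponent (p : ℕ) (R : Type u) [CommRing R] [IsLocalRing R] : ℝ :=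
  (((ringKrullDim R).unbotD 0).toNat : ℝ) +
    Real.logb p (Module.finrank
      (Subfield.closure (Set.range fun x : IsLocalRing.ResidueField R => x ^ p))
      (IsLocalRing.ResidueField R))

/-- `s` is the `F`-signature of `(R, 𝒞)`: with `n` the greatest common divisor of all `e` with
`a_e(R, 𝒞) ≠ 0`, the numbers `a_{en} / p^{enδ}` converge to `s`. If `a_e(R, 𝒞) = 0` for all `e > 0`,
that is, `n = 0`, then the `F`-signature is `0` by convention. -/
def CartierModule.HasFSignature {p : ℕ} {R : Type u} [CommRing R] [IsLocalRing R]
    {C : CartierAlgebra.{u, w} p R} (ρ : CartierModule C R) (s : ℝ) : Prop :=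
  if ρ.splittingPeriod = 0 then s = 0
  else Filter.Tendsto
    (fun e : ℕ => (ρ.splittingNumber (e * ρ.splittingPeriod) : ℝ) /
      ((p : ℝ) ^ (e * ρ.splittingPeriod)) ^ fSigExponent p R)
    Filter.atTop (nhds s)

end

/-!
Write `T = σ(1)`. The formula `T(κ^⊤(s) t) = κ(T(s t^q))`, `q = p^e`, turns every question about
`f^*𝒞` into one about `𝒞`.

*`F`-signature.* Let `Iₑ(R) = {r | κ r ∈ 𝔪 for all κ ∈ 𝒞ₑ}`. Up to the factor `[k^{1/p} : k]^e`,
the number `aₑ` is the colength of `Iₑ`. As `T` is surjective and `T(𝔫) ⊆ 𝔪`, an element `s` lies in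
`Iₑ(S)` if and only if `T(st) ∈ Iₑ(R)` for all `t`. If `R` is not a domain, both signatures vanish.
If it is, a generic isomorphism of finite modules has kernel and cokernel killed by a nonzero
element of `R`, and `Iₑ ⊇ 𝔪^[q]`, so the lengths of `S ⧸ Iₑ(S)` and of `(R ⧸ Iₑ(R))^[L:K]` differ
by `O(q^(d-1))`, where `d = dim R`. The same estimate, applied to `F_*R`, shows that the limits
exist.

*`F`-regularity.* The maps `N ↦ {s | T(sS) ⊆ N}` and `N ↦ T(N)` carry test submodules of `R` to test
submodules of `S` and back. The first yields the unit ideal only for `N = R`, as `T` is surjective,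
the second only for `N = S`, as `T(𝔫) ⊆ 𝔪`.
-/

noncomputable section

open IsLocalRing Filter Topology

/-! ### Lengths -/

section Length

theorem length_compHom_of_isLocalHom {A B : Type*} [CommRing A] [CommRing B] [IsLocalRing A]
    [IsLocalRing B] (φ : A →+* B) [hφ : IsLocalHom φ] (N : Type*) [AddCommGroup N] [Module B N] :
    @Module.length A N _ _ (Module.compHom N φ) =
      Module.length B N * @Module.length A (ResidueField B) _ _ (Module.compHom _ φ) := by
  let _ := φ.toAlgebra
  have : IsLocalHom (algebraMap A B) := hφ
  let _ := Module.compHom N φ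
  have : IsScalarTower A B N := ⟨fun a b n => mul_smul (φ a) b n⟩
  have : IsSimpleModule B (ResidueField B) :=
    isSimpleModule_iff_quot_maximal.2 ⟨maximalIdeal B, inferInstance, ⟨LinearEquiv.refl _ _⟩⟩
  have hk := length_restrictScalars A B (ResidueField B)
  rw [Module.length_eq_one B (ResidueField B), one_mul] at hk
  exact (length_restrictScalars A B N).trans (congrArg _ hk.symm)

theorem length_compHom_of_surjective {A B : Type*} [CommRing A] [CommRing B]
    {φ : A →+* B} (hφ : Function.Surjective φ) (N : Type*) [AddCommGroup N] [Module B N] :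
    @Module.length A N _ _ (Module.compHom N φ) = Module.length B N := by
  let _ := φ.toAlgebra
  let _ := Module.compHom N φ
  have : IsScalarTower A B N := ⟨fun a b n => mul_smul (φ a) b n⟩
  exact Module.length_eq_of_surjective hφ

section Ring

variable {R M P : Type*} [Ring R] [AddCommGroup M] [Module R M] [AddCommGroup P] [Module R P]

theorem length_quotient_anti {N N' : Submodule R M} (h : N ≤ N') :
    Module.length R (M ⧸ N') ≤ Module.length R (M ⧸ N) :=
  Module.length_le_of_surjective _ (Submodule.factor_surjective h)

theorem length_quotient_le_add_sup_range (u : M →ₗ[R] P) {M' : Submodule R M}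
    {P' : Submodule R P} (h : M' ≤ P'.comap u) :
    Module.length R (P ⧸ P') ≤
      Module.length R (M ⧸ M') + Module.length R (P ⧸ (P' ⊔ LinearMap.range u)) := by
  have hle : P' ≤ P' ⊔ LinearMap.range u := le_sup_left
  have hexact : Function.Exact (LinearMap.range (M'.mapQ P' u h)).subtype
      (Submodule.factor hle) := by
    rw [LinearMap.exact_iff, Submodule.range_subtype, Submodule.factor, Submodule.ker_mapQ,
      Submodule.range_mapQ, Submodule.comap_id, Submodule.map_sup, Submodule.mkQ_map_self,
      bot_sup_eq]
  rw [Module.length_eq_add_of_exact _ _ (Submodule.subtype_injective _)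
    (Submodule.factor_surjective hle) hexact]
  gcongr
  exact Module.length_le_of_surjective _ (LinearMap.surjective_rangeRestrict _)

end Ring

variable {R M P : Type*} [CommRing R] [AddCommGroup M] [Module R M] [AddCommGroup P] [Module R P]

theorem length_quotient_le_add_quotient_range (u : M →ₗ[R] P) {M' : Submodule R M}
    {P' : Submodule R P} (h : M' ≤ P'.comap u) {J : Ideal R} (hJ : J • (⊤ : Submodule R P) ≤ P') :
    Module.length R (P ⧸ P') ≤ Module.length R (M ⧸ M') + Module.length R
      ((P ⧸ LinearMap.range u) ⧸ (J • ⊤ : Submodule R (P ⧸ LinearMap.range u))) := by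
  have hle : (J • ⊤ : Submodule R (P ⧸ LinearMap.range u)) ≤
      (P' ⊔ LinearMap.range u).map (LinearMap.range u).mkQ := by
    have htop : (⊤ : Submodule R (P ⧸ LinearMap.range u)) = .map (LinearMap.range u).mkQ ⊤ := by
      rw [Submodule.map_top, Submodule.range_mkQ]
    rw [htop, ← Submodule.map_smul'']
    exact Submodule.map_mono (hJ.trans le_sup_left)
  refine (length_quotient_le_add_sup_range u h).trans ?_
  rw [← (Submodule.quotientQuotientEquivQuotient (LinearMap.range u) (P' ⊔ LinearMap.range u)
    le_sup_right).length_eq]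
  gcongr
  exact length_quotient_anti hle

theorem length_quotient_sup_span_singleton_pow_le (J : Ideal R) (x : R) (n : ℕ) :
    Module.length R (M ⧸ ((J ⊔ Ideal.span {x ^ n}) • ⊤ : Submodule R M)) ≤
      n * Module.length R (M ⧸ ((J ⊔ Ideal.span {x}) • ⊤ : Submodule R M)) := by
  induction n with
  | zero => simp
  | succ n ih =>
    let u : M →ₗ[R] M := LinearMap.lsmul R M (x ^ n)
    have hcomap : ((J ⊔ Ideal.span {x}) • ⊤ : Submodule R M) ≤
        ((J ⊔ Ideal.span {x ^ (n + 1)}) • ⊤ : Submodule R M).comap u := by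
      refine Submodule.smul_le.2 fun r hr m _ => ?_
      obtain ⟨j, hj, y, hy, rfl⟩ := Submodule.mem_sup.1 hr
      obtain ⟨a, rfl⟩ := Ideal.mem_span_singleton'.1 hy
      rw [Submodule.mem_comap, LinearMap.lsmul_apply, smul_smul, mul_add]
      refine Submodule.smul_mem_smul (add_mem (Ideal.mul_mem_left _ _ (Ideal.mem_sup_left hj))
        (Ideal.mem_sup_right ?_)) trivial
      exact Ideal.mem_span_singleton'.2 ⟨a, by ring⟩
    have hsup : ((J ⊔ Ideal.span {x ^ n}) • ⊤ : Submodule R M) ≤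
        ((J ⊔ Ideal.span {x ^ (n + 1)}) • ⊤ : Submodule R M) ⊔ LinearMap.range u := by
      rw [Submodule.sup_smul]
      refine sup_le_sup (Submodule.smul_mono_left le_sup_left)
        (Submodule.smul_le.2 fun r hr m _ => ?_)
      obtain ⟨a, rfl⟩ := Ideal.mem_span_singleton'.1 hr
      exact ⟨a • m, by rw [LinearMap.lsmul_apply, smul_smul, mul_comm]⟩
    calc _ ≤ _ := length_quotient_le_add_sup_range u hcomap
      _ ≤ _ := add_le_add_right ((length_quotient_anti hsup).trans ih) _
      _ = _ := by push_cast; ring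

theorem length_quotient_sup_span_pow_le (s : Finset R) (n : ℕ) (J : Ideal R) :
    Module.length R (M ⧸ ((J ⊔ Ideal.span ((fun x => x ^ n) '' s)) • ⊤ : Submodule R M)) ≤
      n ^ s.card * Module.length R (M ⧸ ((J ⊔ Ideal.span s) • ⊤ : Submodule R M)) := by
  classical
  induction s using Finset.induction_on generalizing J with
  | empty =>
    rw [Finset.coe_empty, Set.image_empty, Finset.card_empty, pow_zero, one_mul]
  | insert a s ha ih =>
    rw [Finset.coe_insert, Set.image_insert_eq, Ideal.span_insert, Ideal.span_insert, ← sup_assoc,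
      Finset.card_insert_of_notMem ha, pow_succ, mul_assoc, sup_comm (Ideal.span {a}), ← sup_assoc]
    refine (ih _).trans ?_
    rw [sup_right_comm]
    gcongr
    exact length_quotient_sup_span_singleton_pow_le _ _ _

theorem length_quotient_smul_top_ne_top [Module.Finite R M] (I : Ideal R)
    [IsArtinianRing (R ⧸ I)] : Module.length R (M ⧸ (I • ⊤ : Submodule R M)) ≠ ⊤ := by
  have : Module.Finite (R ⧸ I) (M ⧸ (I • ⊤ : Submodule R M)) :=
    Module.Finite.of_restrictScalars_finite R _ _
  have hmk : Function.Surjective (algebraMap R (R ⧸ I)) := Ideal.Quotient.mk_surjective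
  rw [Module.length_eq_of_surjective hmk]
  exact Module.length_ne_top

end Length

/-! ### Growth of lengths along Frobenius powers -/

/-- The Krull dimension of a nonzero ring of finite dimension as a natural number; `0` otherwise. -/
def krullDimNat (R : Type*) [CommRing R] : ℕ := ((ringKrullDim R).unbotD 0).toNat

section FrobeniusPower

variable {R : Type*} [CommRing R] [IsLocalRing R] {p : ℕ} [Fact p.Prime] [CharP R p]

variable (R p) in
/-- The Frobenius power `𝔪^[q]`, `q = p ^ e`, of the maximal ideal: the ideal generated by all
`x ^ q` with `x ∈ 𝔪`. -/
def frobeniusPower (e : ℕ) : Ideal R := (maximalIdeal R).map (iterateFrobenius R p e)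

theorem frobeniusPower_le_iff {e : ℕ} {I : Ideal R} :
    frobeniusPower R p e ≤ I ↔ ∀ x ∈ maximalIdeal R, x ^ p ^ e ∈ I := by
  rw [frobeniusPower, Ideal.map_le_iff_le_comap]
  simp only [SetLike.le_def, Ideal.mem_comap, iterateFrobenius_def]

theorem pow_mem_frobeniusPower (e : ℕ) {x : R} (hx : x ∈ maximalIdeal R) :
    x ^ p ^ e ∈ frobeniusPower R p e :=
  frobeniusPower_le_iff.1 le_rfl x hx

theorem pow_mem_frobeniusPower_add {e : ℕ} (f : ℕ) {x : R} (hx : x ∈ frobeniusPower R p e) :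
    x ^ p ^ f ∈ frobeniusPower R p (e + f) := by
  suffices h : frobeniusPower R p e ≤ (frobeniusPower R p (e + f)).comap (iterateFrobenius R p f) by
    simpa only [Ideal.mem_comap, iterateFrobenius_def] using h hx
  refine frobeniusPower_le_iff.2 fun y hy => ?_
  rw [Ideal.mem_comap, iterateFrobenius_def, ← pow_mul, ← pow_add]
  exact pow_mem_frobeniusPower (e + f) hy

end FrobeniusPower

section SystemOfParameters

variable {R : Type*} [CommRing R] [IsLocalRing R]

section Noetherian

variable [IsNoetherianRing R]

theorem height_maximalIdeal_eq_krullDimNat : (maximalIdeal R).height = krullDimNat R := by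
  rw [krullDimNat, ← maximalIdeal_height_eq_ringKrullDim, WithBot.unbotD_coe,
    ENat.natCast_toNat (Ideal.height_ne_top Ideal.IsPrime.ne_top')]

theorem ringKrullDim_eq_krullDimNat : ringKrullDim R = krullDimNat R := by
  rw [← maximalIdeal_height_eq_ringKrullDim, height_maximalIdeal_eq_krullDimNat]
  rfl

theorem exists_systemOfParameters :
    ∃ s : Finset R, (∀ x ∈ s, x ∈ maximalIdeal R) ∧ s.card = krullDimNat R ∧
      IsArtinianRing (R ⧸ Ideal.span (s : Set R)) := by
  obtain ⟨s, hs, hcard⟩ := Ideal.exists_finset_card_eq_height_of_isNoetherianRing (maximalIdeal R)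
  rw [height_maximalIdeal_eq_krullDimNat] at hcard
  exact ⟨s, fun x hx => hs.1.2 (Ideal.subset_span hx), by exact_mod_cast hcard,
    quotient_artinian_of_mem_minimalPrimes_of_isLocalRing _ hs⟩

theorem exists_systemOfParameters_quotient_nonZeroDivisor {c : R} (hc : c ∈ nonZeroDivisors R)
    (hcm : c ∈ maximalIdeal R) :
    ∃ s : Finset R, (∀ x ∈ s, x ∈ maximalIdeal R) ∧ s.card + 1 ≤ krullDimNat R ∧
      IsArtinianRing (R ⧸ (Ideal.span {c} ⊔ Ideal.span (s : Set R))) := by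
  classical
  let mk := Ideal.Quotient.mk (Ideal.span {c})
  have hmk : Function.Surjective mk := Ideal.Quotient.mk_surjective
  have : Nontrivial (R ⧸ Ideal.span {c}) := Ideal.Quotient.nontrivial_iff.2 fun h =>
    Ideal.IsPrime.ne_top' (top_le_iff.1 (h ▸ (Ideal.span_singleton_le_iff_mem _).2 hcm))
  have : IsLocalRing (R ⧸ Ideal.span {c}) := IsLocalRing.of_surjective' _ hmk
  obtain ⟨t, htm, htcard, hart⟩ := exists_systemOfParameters (R := R ⧸ Ideal.span {c})
  let lift := Function.surjInv hmk
  have hlift (x) : mk (lift x) = x := Function.surjInv_eq hmk x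
  refine ⟨t.image lift, Finset.forall_mem_image.2 fun y hy => ?_, ?_, ?_⟩
  · exact fun hu => htm y hy (hlift y ▸ hu.map mk)
  · have hdim := ringKrullDim_quotient_succ_le_of_nonZeroDivisor hc
    rw [ringKrullDim_eq_krullDimNat, ringKrullDim_eq_krullDimNat, ← htcard] at hdim
    exact (Nat.add_le_add_right Finset.card_image_le 1).trans (by exact_mod_cast hdim)
  · have hmap : (Ideal.span ((t.image lift : Finset R) : Set R)).map mk = Ideal.span t := by
      simp only [Ideal.map_span, Finset.coe_image, Set.image_image, hlift, Set.image_id']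
    rw [← hmap] at hart
    exact (DoubleQuot.quotQuotEquivQuotSup (Ideal.span {c}) _).surjective.isArtinianRing

end Noetherian

variable (p : ℕ) [Fact p.Prime] [CharP R p]
  (N : Type*) [AddCommGroup N] [Module R N] [Module.Finite R N]

theorem exists_length_quotient_frobeniusPower_le_pow_card {J : Ideal R} {s : Finset R}
    (hs : ∀ x ∈ s, x ∈ maximalIdeal R) [IsArtinianRing (R ⧸ (J ⊔ Ideal.span (s : Set R)))]
    (hJ : J • (⊤ : Submodule R N) = ⊥) :
    ∃ D : ℕ, ∀ e : ℕ, Module.length R (N ⧸ (frobeniusPower R p e • ⊤ : Submodule R N)) ≤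
      D * (p ^ e) ^ s.card := by
  obtain ⟨D, hD⟩ := ENat.ne_top_iff_exists.1
    (length_quotient_smul_top_ne_top (M := N) (J ⊔ Ideal.span (s : Set R)))
  have hle (e : ℕ) : ((J ⊔ Ideal.span ((fun x => x ^ p ^ e) '' s)) • ⊤ : Submodule R N) ≤
      frobeniusPower R p e • ⊤ := by
    rw [Submodule.sup_smul, hJ, bot_sup_eq]
    refine Submodule.smul_mono_left (Ideal.span_le.2 ?_)
    rintro _ ⟨x, hx, rfl⟩
    exact pow_mem_frobeniusPower e (hs x hx)
  refine ⟨D, fun e => ?_⟩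
  calc _ ≤ _ := length_quotient_anti (hle e)
    _ ≤ _ := length_quotient_sup_span_pow_le s (p ^ e) J
    _ = D * (p ^ e) ^ s.card := by rw [← hD, mul_comm]; push_cast; rfl

variable [IsNoetherianRing R]

theorem exists_length_quotient_frobeniusPower_le :
    ∃ D : ℕ, ∀ e : ℕ, Module.length R (N ⧸ (frobeniusPower R p e • ⊤ : Submodule R N)) ≤
      D * (p ^ e) ^ krullDimNat R := by
  obtain ⟨s, hs, hcard, hart⟩ := exists_systemOfParameters (R := R)
  have : IsArtinianRing (R ⧸ ((⊥ : Ideal R) ⊔ Ideal.span (s : Set R))) := by rwa [bot_sup_eq]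
  rw [← hcard]
  exact exists_length_quotient_frobeniusPower_le_pow_card p N hs (Submodule.bot_smul _)

theorem exists_length_quotient_frobeniusPower_mul_le {c : R} (hc : c ∈ nonZeroDivisors R)
    (hcN : ∀ n : N, c • n = 0) :
    ∃ D : ℕ, ∀ e : ℕ, Module.length R (N ⧸ (frobeniusPower R p e • ⊤ : Submodule R N)) * p ^ e ≤
      D * (p ^ e) ^ krullDimNat R := by
  by_cases hu : IsUnit c
  · have : Subsingleton N := subsingleton_of_forall_eq 0 fun n => (hu.smul_eq_zero).1 (hcN n)
    exact ⟨0, fun e => by simp⟩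
  obtain ⟨s, hs, hcard, hart⟩ := exists_systemOfParameters_quotient_nonZeroDivisor hc
    ((mem_maximalIdeal c).2 hu)
  have hcN_bot : Ideal.span {c} • (⊤ : Submodule R N) = ⊥ := by
    rw [← Submodule.le_annihilator_iff, Ideal.span_singleton_le_iff_mem,
      Submodule.mem_annihilator]
    exact fun n _ => hcN n
  obtain ⟨D, hD⟩ := exists_length_quotient_frobeniusPower_le_pow_card p N hs hcN_bot
  have hq (e : ℕ) : 1 ≤ (p ^ e : ℕ∞) := by
    exact_mod_cast Nat.one_le_pow e p (Fact.out : p.Prime).pos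
  refine ⟨D, fun e => ?_⟩
  calc _ ≤ (D * (p ^ e : ℕ∞) ^ s.card) * p ^ e := by gcongr; exact hD e
    _ = D * (p ^ e : ℕ∞) ^ (s.card + 1) := by rw [mul_assoc, pow_succ]
    _ ≤ _ := by gcongr; exact hq e

theorem exists_length_quotient_mul_le_add {M P : Type*} [AddCommGroup M] [Module R M]
    [AddCommGroup P] [Module R P] [Module.Finite R P] (u : M →ₗ[R] P) {c : R}
    (hc : c ∈ nonZeroDivisors R) (hu : ∀ y, c • y ∈ LinearMap.range u) :
    ∃ D : ℕ, ∀ (e : ℕ) {M' : Submodule R M} {P' : Submodule R P}, M' ≤ P'.comap u →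
      frobeniusPower R p e • ⊤ ≤ P' → Module.length R (P ⧸ P') * p ^ e ≤
        Module.length R (M ⧸ M') * p ^ e + D * (p ^ e) ^ krullDimNat R := by
  have hcu (n : P ⧸ LinearMap.range u) : c • n = 0 := by
    obtain ⟨y, rfl⟩ := Submodule.mkQ_surjective _ n
    rw [← map_smul, Submodule.mkQ_apply, Submodule.Quotient.mk_eq_zero]
    exact hu y
  obtain ⟨D, hD⟩ := exists_length_quotient_frobeniusPower_mul_le p (P ⧸ LinearMap.range u) hc hcu
  refine ⟨D, fun e M' P' hM' hP' => ?_⟩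
  calc _ ≤ _ := mul_le_mul_left (length_quotient_le_add_quotient_range u hM' hP') ((p : ℕ∞) ^ e)
    _ ≤ _ := (add_mul _ _ _).le.trans (add_le_add_right (hD e) _)

end SystemOfParameters

/-! ### Modules over domains -/

section Domain

variable {R : Type*} [CommRing R] [IsDomain R] {M : Type*} [AddCommGroup M] [Module R M]

section Finite

variable [Module.Finite R M]

theorem exists_smul_mem_of_finrank_eq (N : Submodule R M)
    (h : Module.finrank R N = Module.finrank R M) : ∃ c : R, c ≠ 0 ∧ ∀ m : M, c • m ∈ N := by
  have hrank : Module.finrank R (M ⧸ N) = 0 := by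
    have := N.finrank_quotient_add_finrank
    omega
  obtain ⟨c, hc, hc0⟩ := Submodule.annihilator_top_inter_nonZeroDivisors
    (Module.finrank_eq_zero_iff_isTorsion.1 hrank)
  refine ⟨c, nonZeroDivisors.ne_zero hc0, fun m => ?_⟩
  have := Submodule.mem_annihilator.1 hc (N.mkQ m) trivial
  rwa [← map_smul, Submodule.mkQ_apply, Submodule.Quotient.mk_eq_zero] at this

variable (R M) in
theorem exists_linearIndependent_smul_mem_span :
    ∃ g : Fin (Module.finrank R M) → M, LinearIndependent R g ∧
      ∃ c : R, c ≠ 0 ∧ ∀ m : M, c • m ∈ Submodule.span R (Set.range g) := by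
  obtain ⟨g, hg⟩ := exists_linearIndependent_of_le_finrank (le_refl (Module.finrank R M))
  refine ⟨g, hg, exists_smul_mem_of_finrank_eq _ ?_⟩
  rw [finrank_span_eq_card hg, Fintype.card_fin]

end Finite

theorem exists_smul_mem_range_pi_flip {N : Type*} [AddCommGroup N] [Module R N]
    {β : M →ₗ[R] N →ₗ[R] R} (hβ : Function.Injective β)
    {g : Fin (Module.finrank R M) → N} {c : R} (hc : c ≠ 0)
    (hg : ∀ n : N, c • n ∈ Submodule.span R (Set.range g)) :
    ∃ c' : R, c' ≠ 0 ∧ ∀ y, c' • y ∈ LinearMap.range (LinearMap.pi fun i => β.flip (g i)) := by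
  apply exists_smul_mem_of_finrank_eq
  have hinj : Function.Injective (LinearMap.pi fun i => β.flip (g i)) := by
    refine (injective_iff_map_eq_zero _).2 fun m hm => (map_eq_zero_iff β hβ).1 ?_
    have hker : Submodule.span R (Set.range g) ≤ LinearMap.ker (β m) :=
      Submodule.span_le.2 (Set.range_subset_iff.2 (congrFun hm))
    ext n
    have hcn := LinearMap.mem_ker.1 (hker (hg n))
    rw [map_smul] at hcn
    exact (smul_eq_zero.1 hcn).resolve_left hc
  rw [LinearMap.finrank_range_of_inj hinj, Module.finrank_fin_fun]

end Domain

/-! ### Frobenius push-forward -/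

/-- The Frobenius push-forward `Fᵉ_* M`: the additive group `M`, on which `r ∈ R` acts as
`r ^ p ^ e`. The parameters `p` and `e` only serve to find this module structure. -/
def FrobPush (_p _e : ℕ) (M : Type*) : Type _ := M

namespace FrobPush

variable (p e : ℕ)

instance (M : Type*) [AddCommGroup M] : AddCommGroup (FrobPush p e M) :=
  inferInstanceAs (AddCommGroup M)

/-- The identity map `M → Fᵉ_* M`. -/
def of {M : Type*} [AddCommGroup M] : M ≃+ FrobPush p e M := AddEquiv.refl M

/-- The degree `[k : k^p]` of the residue field `k` of `R`, which is also `[k^{1/p} : k]`. -/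
def residueDegree (R : Type*) [CommRing R] [IsLocalRing R] : ℕ :=
  Module.finrank (Subfield.closure (Set.range fun x : ResidueField R => x ^ p)) (ResidueField R)

variable [Fact p.Prime] {R : Type*} [CommRing R] [CharP R p]
  {M : Type*} [AddCommGroup M] [Module R M] {N : Type*} [AddCommGroup N] [Module R N]

instance : Module R (FrobPush p e M) := Module.compHom M (iterateFrobenius R p e)

theorem smul_of (r : R) (m : M) : r • of p e m = of p e (r ^ p ^ e • m) := by
  rw [← iterateFrobenius_def p e r]
  rfl

/-- The functor `Fᵉ_*` on linear maps. -/
def map (f : M →ₗ[R] N) : FrobPush p e M →ₗ[R] FrobPush p e N where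
  toFun x := of p e (f ((of p e).symm x))
  map_add' _ _ := map_add f _ _
  map_smul' r x := map_smul f (iterateFrobenius R p e r) ((of p e).symm x)

theorem map_surjective {f : M →ₗ[R] N} (hf : Function.Surjective f) :
    Function.Surjective (map p e f) := fun y =>
  let ⟨x, hx⟩ := hf ((of p e).symm y)
  ⟨of p e x, hx⟩

/-- `Fᵉ_* N` as a submodule of `Fᵉ_* M`. -/
def submodule (N : Submodule R M) : Submodule R (FrobPush p e M) where
  carrier := {x | (of p e).symm x ∈ N}
  zero_mem' := N.zero_mem
  add_mem' hx hy := N.add_mem hx hy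
  smul_mem' r _ hx := N.smul_mem (iterateFrobenius R p e r) hx

theorem of_mem_submodule {N : Submodule R M} {m : M} : of p e m ∈ submodule p e N ↔ m ∈ N :=
  Iff.rfl

theorem ker_map_mkQ (N : Submodule R M) : LinearMap.ker (map p e N.mkQ) = submodule p e N :=
  Submodule.ext fun x => Submodule.Quotient.mk_eq_zero N (x := (of p e).symm x)

/-- The isomorphism `F^{a+b}_* = F^b_* F^a_*`. -/
def addEquiv (a b : ℕ) : FrobPush p (a + b) M ≃ₗ[R] FrobPush p b (FrobPush p a M) where
  toFun x := of p b (of p a ((of p (a + b)).symm x))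
  invFun x := of p (a + b) ((of p a).symm ((of p b).symm x))
  left_inv _ := rfl
  right_inv _ := rfl
  map_add' _ _ := rfl
  map_smul' r x := by
    obtain ⟨x, rfl⟩ := (of p (a + b)).surjective x
    rw [smul_of]
    simp only [AddEquiv.symm_apply_apply, RingHom.id_apply]
    rw [smul_of, smul_of, ← pow_mul, ← pow_add, add_comm b a]

theorem finite_iterateFrobenius (hF : (frobenius R p).Finite) :
    (iterateFrobenius R p e).Finite := by
  induction e with
  | zero => rw [iterateFrobenius_zero]; exact RingHom.Finite.id R
  | succ e ih =>
    rw [iterateFrobenius_add, iterateFrobenius_one]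
    exact ih.comp hF

theorem module_finite (hF : (frobenius R p).Finite) : Module.Finite R (FrobPush p e R) :=
  finite_iterateFrobenius p e hF

theorem module_finite_quotient (hF : (frobenius R p).Finite) (I : Ideal R) :
    Module.Finite R (FrobPush p e (R ⧸ I)) :=
  have := module_finite p e hF
  Module.Finite.of_surjective _ (map_surjective p e I.mkQ_surjective)

variable [IsLocalRing R]

instance : IsLocalHom (iterateFrobenius R p e) where
  map_nonunit a ha := by
    rw [iterateFrobenius_def] at ha
    exact (isUnit_pow_iff (pow_ne_zero e (Fact.out : p.Prime).ne_zero)).1 ha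

theorem length_eq_mul : Module.length R (FrobPush p e M) =
    Module.length R M * Module.length R (FrobPush p e (ResidueField R)) :=
  length_compHom_of_isLocalHom (iterateFrobenius R p e) M

theorem length_residueField_one (hF : (frobenius R p).Finite) :
    Module.length R (FrobPush p 1 (ResidueField R)) = residueDegree p R := by
  let k := ResidueField R
  have : CharP k p := (CharP.charP_iff_prime_eq_zero Fact.out).2 <| by
    rw [← map_natCast (residue R), CharP.cast_eq_zero, map_zero]
  let F := iterateFrobenius k p 1
  have hclosure : Subfield.closure (Set.range fun x : k => x ^ p) = F.fieldRange := by
    rw [← Subfield.closure_eq F.fieldRange, RingHom.coe_fieldRange]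
    refine congrArg (fun f => Subfield.closure (Set.range f)) (funext fun x => ?_)
    rw [iterateFrobenius_def, pow_one]
  have : IsScalarTower R k (FrobPush p 1 k) := .of_algebraMap_smul fun r x => by
    obtain ⟨x, rfl⟩ := (of p 1).surjective x
    rw [smul_of, smul_of, ← map_pow, algebraMap_smul]
  have hlength : Module.length k (FrobPush p 1 k) = Module.length F.fieldRange k :=
    length_compHom_of_surjective F.rangeRestrictField_bijective.surjective k
  have : Module.Finite R (FrobPush p 1 k) := module_finite_quotient p 1 hF (maximalIdeal R)
  have : Module.Finite k (FrobPush p 1 k) := .of_restrictScalars_finite R k _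
  have : IsNoetherian F.fieldRange k := (isFiniteLength_iff_isNoetherian_isArtinian.1
    (Module.length_ne_top_iff.1 (hlength ▸ Module.length_ne_top))).1
  rw [residueDegree, hclosure, ← Module.length_eq_finrank, ← hlength]
  exact Module.length_eq_of_surjective residue_surjective

theorem residueDegree_pos (hF : (frobenius R p).Finite) : 0 < residueDegree p R := by
  refine Nat.pos_of_ne_zero fun h => not_subsingleton (ResidueField R) ?_
  have hlength := length_residueField_one p hF
  rwa [h, Nat.cast_zero, Module.length_eq_zero_iff] at hlength

theorem length_residueField (hF : (frobenius R p).Finite) :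
    Module.length R (FrobPush p e (ResidueField R)) = (residueDegree p R : ℕ∞) ^ e := by
  induction e with
  | zero =>
    have hid : Function.Surjective (iterateFrobenius R p 0) := fun r =>
      ⟨r, iterateFrobenius_zero_apply R p r⟩
    have : IsSimpleModule R (ResidueField R) :=
      isSimpleModule_iff_quot_maximal.2 ⟨maximalIdeal R, inferInstance, ⟨LinearEquiv.refl _ _⟩⟩
    rw [pow_zero, ← Module.length_eq_one R (ResidueField R)]
    exact length_compHom_of_surjective hid (ResidueField R)
  | succ e ih =>
    rw [(addEquiv p (R := R) (M := ResidueField R) e 1).length_eq, length_eq_mul, ih,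
      length_residueField_one p hF, pow_succ]

theorem length_quotient (hF : (frobenius R p).Finite) (N : Submodule R M) :
    Module.length R (FrobPush p e M ⧸ submodule p e N) =
      Module.length R (M ⧸ N) * (residueDegree p R : ℕ∞) ^ e := by
  rw [← ker_map_mkQ, ((map p e N.mkQ).quotKerEquivOfSurjective
    (map_surjective p e N.mkQ_surjective)).length_eq, length_eq_mul, length_residueField p e hF]

end FrobPush

/-! ### Duality over the residue field -/

section Duality

variable {R k X B : Type*} [CommRing R] [Field k] [Algebra R k] [AddCommGroup X] [Module R X]
  [AddCommGroup B] [Module R B]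

theorem length_linearMap_le (hk : Function.Surjective (algebraMap R k)) :
    Module.length R (B →ₗ[R] k) ≤ Module.length R B := by
  by_cases htop : Module.length R B = ⊤
  · exact htop ▸ le_top
  have : IsNoetherian R B :=
    (isFiniteLength_iff_isNoetherian_isArtinian.1 (Module.length_ne_top_iff.1 htop)).1
  calc Module.length R (B →ₗ[R] k) = Module.length k (Module.Dual k (k ⊗[R] B)) :=
        (Module.length_eq_of_surjective hk).trans (LinearMap.liftBaseChangeEquiv k).length_eq
    _ = Module.length k (k ⊗[R] B) := by
        rw [Module.length_eq_finrank, Module.length_eq_finrank, Subspace.dual_finrank_eq]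
    _ = Module.length R (k ⊗[R] B) := (Module.length_eq_of_surjective hk).symm
    _ ≤ Module.length R B := Module.length_le_of_surjective (TensorProduct.mk R k B 1)
        (TensorProduct.mk_surjective R B k hk)

theorem length_quotient_ker_le_flip (hk : Function.Surjective (algebraMap R k))
    (ψ : X →ₗ[R] B →ₗ[R] k) :
    Module.length R (X ⧸ LinearMap.ker ψ) ≤ Module.length R (B ⧸ LinearMap.ker ψ.flip) := by
  let ψ' : X →ₗ[R] (B ⧸ LinearMap.ker ψ.flip) →ₗ[R] k :=
    ((LinearMap.ker ψ.flip).liftQ ψ.flip le_rfl).flip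
  have hker : LinearMap.ker ψ = LinearMap.ker ψ' := by
    ext x
    rw [LinearMap.mem_ker, LinearMap.mem_ker, LinearMap.ext_iff, LinearMap.ext_iff,
      (LinearMap.ker ψ.flip).mkQ_surjective.forall]
    rfl
  rw [hker]
  exact (Module.length_le_of_injective (ψ'.ker.liftQ ψ' le_rfl)
    (LinearMap.ker_eq_bot.1 (Submodule.ker_liftQ_eq_bot' _ _ rfl))).trans (length_linearMap_le hk)

theorem length_quotient_ker_flip (hk : Function.Surjective (algebraMap R k))
    (ψ : X →ₗ[R] B →ₗ[R] k) :
    Module.length R (X ⧸ LinearMap.ker ψ) = Module.length R (B ⧸ LinearMap.ker ψ.flip) :=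
  (length_quotient_ker_le_flip hk ψ).antisymm (length_quotient_ker_le_flip hk ψ.flip)

end Duality

/-! ### Splitting ideals -/

section Pi

variable {R : Type*} [CommRing R] (n : ℕ)

theorem length_quotient_pi_ideal (I : Ideal R) :
    Module.length R ((Fin n → R) ⧸ Submodule.pi Set.univ fun _ : Fin n => I) =
      n * Module.length R (R ⧸ I) := by
  rw [(Submodule.quotientPi fun _ : Fin n => I).length_eq, Module.length_pi,
    ENat.card_eq_coe_fintype_card, Fintype.card_fin]

theorem smul_top_le_pi_ideal {J I : Ideal R} (h : J ≤ I) :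
    J • (⊤ : Submodule R (Fin n → R)) ≤ Submodule.pi Set.univ fun _ : Fin n => I :=
  Submodule.smul_le.2 fun _ hr _ _ _ _ => I.mul_mem_right _ (h hr)

end Pi

section Colength

/-- The length of `R ⧸ I` as a natural number; `0` if this length is infinite. -/
def colength {R : Type*} [CommRing R] (I : Ideal R) : ℕ := (Module.length R (R ⧸ I)).toNat

variable {R : Type*} [CommRing R] [IsLocalRing R] [IsNoetherianRing R] (p : ℕ) [Fact p.Prime]
  [CharP R p]

theorem exists_length_quotient_le_of_frobeniusPower_le : ∃ D : ℕ, ∀ (e : ℕ) (I : Ideal R),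
    frobeniusPower R p e ≤ I → Module.length R (R ⧸ I) ≤ D * (p ^ e) ^ krullDimNat R := by
  obtain ⟨D, hD⟩ := exists_length_quotient_frobeniusPower_le (R := R) p R
  refine ⟨D, fun e I hI => (length_quotient_anti ?_).trans (hD e)⟩
  rw [smul_eq_mul, Ideal.mul_top]
  exact hI

theorem coe_colength {e : ℕ} {I : Ideal R} (hI : frobeniusPower R p e ≤ I) :
    (colength I : ℕ∞) = Module.length R (R ⧸ I) := by
  obtain ⟨D, hD⟩ := exists_length_quotient_le_of_frobeniusPower_le (R := R) p
  refine ENat.natCast_toNat (ne_top_of_le_ne_top ?_ (hD e I hI))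
  exact_mod_cast ENat.natCast_ne_top (D * (p ^ e) ^ krullDimNat R)

theorem colength_ne_zero_iff {e : ℕ} {I : Ideal R} (hI : frobeniusPower R p e ≤ I) :
    colength I ≠ 0 ↔ I ≠ ⊤ := by
  rw [← Nat.cast_ne_zero (R := ℕ∞), coe_colength p hI, Ne, Module.length_eq_zero_iff,
    Submodule.Quotient.subsingleton_iff]

end Colength

namespace CartierModule

variable {p : ℕ} {R : Type u} [CommRing R] {C : CartierAlgebra.{u, w} p R} (ρ : CartierModule C R)

section SplitIdeal

variable [IsLocalRing R]

/-- The splitting ideal `Iₑ` of all `r ∈ R` with `κ r ∈ 𝔪` for all `κ ∈ 𝒞ₑ`. -/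
def splitIdeal (e : ℕ) : Ideal R where
  carrier := {r | ∀ x : C.deg e, ρ.act e x r ∈ maximalIdeal R}
  zero_mem' x := by rw [map_zero]; exact zero_mem _
  add_mem' hr hs x := by rw [map_add]; exact add_mem (hr x) (hs x)
  smul_mem' c r hr x := by rw [← ρ.act_right]; exact hr _

theorem mem_splitIdeal {e : ℕ} {r : R} :
    r ∈ ρ.splitIdeal e ↔ ∀ x : C.deg e, ρ.act e x r ∈ maximalIdeal R := Iff.rfl

theorem act_mem_splitIdeal {e f : ℕ} (x : C.deg f) {r : R} (hr : r ∈ ρ.splitIdeal (e + f)) :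
    ρ.act f x r ∈ ρ.splitIdeal e := fun y => by
  rw [← ρ.act_mul rfl]
  exact hr _

theorem exists_act_eq_one {e : ℕ} (h : ρ.splitIdeal e ≠ ⊤) :
    ∃ (x : C.deg e) (r : R), ρ.act e x r = 1 := by
  have hone : (1 : R) ∉ ρ.splitIdeal e := (Ideal.ne_top_iff_one _).1 h
  rw [mem_splitIdeal] at hone
  push Not at hone
  obtain ⟨x, hx⟩ := hone
  rw [mem_maximalIdeal, mem_nonunits_iff, not_not] at hx
  obtain ⟨b, hb⟩ := hx.exists_left_inv
  exact ⟨x, b ^ p ^ e • 1, by rw [ρ.isCartierLinear, smul_eq_mul, hb]⟩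

theorem splitIdeal_add_ne_top {e f : ℕ} (he : ρ.splitIdeal e ≠ ⊤) (hf : ρ.splitIdeal f ≠ ⊤) :
    ρ.splitIdeal (e + f) ≠ ⊤ := by
  obtain ⟨x, r, hx⟩ := ρ.exists_act_eq_one he
  obtain ⟨y, s, hy⟩ := ρ.exists_act_eq_one hf
  intro htop
  have hmem : r ^ p ^ f * s ∈ ρ.splitIdeal (e + f) := htop ▸ trivial
  have hone := hmem (C.mul rfl x y)
  rw [ρ.act_mul, ← smul_eq_mul, ρ.isCartierLinear, hy, smul_eq_mul, mul_one, hx] at hone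
  exact (Ideal.ne_top_iff_one _).1 Ideal.IsPrime.ne_top' hone

end SplitIdeal

variable [Fact p.Prime] [CharP R p]

/-- The `R`-bilinear form `(a, b) ↦ κ (a b)` on `Fᵉ_* R`, for `κ ∈ 𝒞ₑ`. -/
def actForm {e : ℕ} (x : C.deg e) : FrobPush p e R →ₗ[R] FrobPush p e R →ₗ[R] R :=
  LinearMap.mk₂ R
    (fun a b => ρ.act e x ((FrobPush.of p e).symm a * (FrobPush.of p e).symm b))
    (fun a a' b => by rw [map_add, add_mul, map_add])
    (fun r a b => by
      obtain ⟨a, rfl⟩ := (FrobPush.of p e).surjective a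
      rw [FrobPush.smul_of, AddEquiv.symm_apply_apply, AddEquiv.symm_apply_apply, smul_mul_assoc,
        ρ.isCartierLinear])
    (fun a b b' => by rw [map_add, mul_add, map_add])
    (fun r a b => by
      obtain ⟨b, rfl⟩ := (FrobPush.of p e).surjective b
      rw [FrobPush.smul_of, AddEquiv.symm_apply_apply, AddEquiv.symm_apply_apply, mul_smul_comm,
        ρ.isCartierLinear])

theorem actForm_injective {e : ℕ} {x : C.deg e} {r : R} (hx : ρ.act e x r = 1) :
    Function.Injective (ρ.actForm x) := by
  rw [injective_iff_map_eq_zero]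
  intro a ha
  obtain ⟨a, rfl⟩ := (FrobPush.of p e).surjective a
  have hzero : ρ.act e x (a * (a ^ (p ^ e - 1) * r)) = 0 :=
    LinearMap.congr_fun ha (FrobPush.of p e (a ^ (p ^ e - 1) * r))
  rw [← mul_assoc, mul_pow_sub_one (pow_ne_zero e (Fact.out : p.Prime).ne_zero), ← smul_eq_mul,
    ρ.isCartierLinear, hx, smul_eq_mul, mul_one] at hzero
  rw [hzero, map_zero]

variable [IsLocalRing R]

theorem frobeniusPower_le_splitIdeal (e : ℕ) : frobeniusPower R p e ≤ ρ.splitIdeal e := by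
  refine frobeniusPower_le_iff.2 fun r hr x => ?_
  have hlin := ρ.isCartierLinear x r 1
  rw [smul_eq_mul, mul_one] at hlin
  rw [hlin]
  exact Ideal.mul_mem_right _ _ hr

/-- The action of `κ ∈ 𝒞ₑ` as a linear map `Fᵉ_* R → R`. -/
def actPush {e : ℕ} (x : C.deg e) : FrobPush p e R →ₗ[R] R where
  toFun r := ρ.act e x ((FrobPush.of p e).symm r)
  map_add' _ _ := map_add _ _ _
  map_smul' r m := by
    obtain ⟨m, rfl⟩ := (FrobPush.of p e).surjective m
    rw [FrobPush.smul_of]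
    exact ρ.isCartierLinear x r m

/-- The pairing `𝒞ₑ × Fᵉ_* R → k`, `(κ, r) ↦ κ r mod 𝔪`, where `k` is the residue field. -/
def pairing (e : ℕ) : C.LDeg e →ₗ[R] FrobPush p e R →ₗ[R] ResidueField R where
  toFun x := (Algebra.linearMap R (ResidueField R)).comp (ρ.actPush x.val)
  map_add' x y := by
    ext m
    change residue R (ρ.act e (x.val + y.val) _) = residue R _ + residue R _
    rw [map_add, AddMonoidHom.add_apply, map_add]
    rfl
  map_smul' r x := by
    ext m
    change residue R (ρ.act e (C.mul (zero_add e) (C.coeff r) x.val) _) = r • residue R _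
    rw [ρ.act_mul, ρ.act_coeff, smul_eq_mul, map_mul]
    rfl

theorem ker_pairing (e : ℕ) : LinearMap.ker (ρ.pairing e) = ρ.nonSurj e := by
  ext x
  rw [LinearMap.mem_ker, LinearMap.ext_iff]
  exact forall_congr' fun r => residue_eq_zero_iff (ρ.act e x.val r)

theorem ker_flip_pairing (e : ℕ) :
    LinearMap.ker (ρ.pairing e).flip = FrobPush.submodule p e (ρ.splitIdeal e) := by
  ext r
  rw [LinearMap.mem_ker, LinearMap.ext_iff]
  exact ⟨fun h x => (residue_eq_zero_iff _).1 (h ⟨x⟩),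
    fun h x => (residue_eq_zero_iff _).2 (h x.val)⟩

theorem length_quotient_nonSurj (hF : (frobenius R p).Finite) (e : ℕ) :
    Module.length R (C.LDeg e ⧸ ρ.nonSurj e) =
      Module.length R (R ⧸ ρ.splitIdeal e) * (FrobPush.residueDegree p R : ℕ∞) ^ e := by
  rw [← ρ.ker_pairing, length_quotient_ker_flip residue_surjective, ρ.ker_flip_pairing,
    FrobPush.length_quotient p e hF]

variable [IsNoetherianRing R]

theorem splittingNumber_eq (hF : (frobenius R p).Finite) (e : ℕ) :
    ρ.splittingNumber e = colength (ρ.splitIdeal e) * FrobPush.residueDegree p R ^ e := by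
  rw [splittingNumber, ρ.length_quotient_nonSurj hF,
    ← coe_colength p (ρ.frobeniusPower_le_splitIdeal e)]
  exact_mod_cast ENat.toNat_natCast _

theorem splittingNumber_ne_zero_iff (hF : (frobenius R p).Finite) (e : ℕ) :
    ρ.splittingNumber e ≠ 0 ↔ ρ.splitIdeal e ≠ ⊤ := by
  rw [ρ.splittingNumber_eq hF, mul_ne_zero_iff,
    colength_ne_zero_iff p (ρ.frobeniusPower_le_splitIdeal e)]
  exact and_iff_left (pow_ne_zero e (FrobPush.residueDegree_pos p hF).ne')

theorem exists_rank_mul_colength_le [IsDomain R] (hF : (frobenius R p).Finite) {f : ℕ}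
    (hf : ρ.splitIdeal f ≠ ⊤) : ∃ D : ℕ, ∀ e : ℕ,
      Module.finrank R (FrobPush p f R) * colength (ρ.splitIdeal e) * p ^ e ≤
        colength (ρ.splitIdeal (e + f)) * FrobPush.residueDegree p R ^ f * p ^ e +
          D * (p ^ e) ^ krullDimNat R := by
  have hfin := FrobPush.module_finite p f hF
  obtain ⟨x, r, hx⟩ := ρ.exists_act_eq_one hf
  obtain ⟨g, -, c, hc, hg⟩ := exists_linearIndependent_smul_mem_span R (FrobPush p f R)
  obtain ⟨c', hc', hu⟩ := exists_smul_mem_range_pi_flip (ρ.actForm_injective hx) hc hg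
  obtain ⟨D, hD⟩ := exists_length_quotient_mul_le_add p
    (LinearMap.pi fun i => (ρ.actForm x).flip (g i)) (mem_nonZeroDivisors_of_ne_zero hc') hu
  refine ⟨D, fun e => ?_⟩
  have hcomap : FrobPush.submodule p f (ρ.splitIdeal (e + f)) ≤
      (Submodule.pi Set.univ fun _ => ρ.splitIdeal e).comap
        (LinearMap.pi fun i => (ρ.actForm x).flip (g i)) :=
    fun m hm i _ => ρ.act_mem_splitIdeal x (Ideal.mul_mem_right _ _ hm)
  have hle := hD e hcomap (smul_top_le_pi_ideal _ (ρ.frobeniusPower_le_splitIdeal e))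
  rw [length_quotient_pi_ideal, FrobPush.length_quotient p f hF,
    ← coe_colength p (ρ.frobeniusPower_le_splitIdeal e),
    ← coe_colength p (ρ.frobeniusPower_le_splitIdeal (e + f))] at hle
  exact_mod_cast hle

end CartierModule

theorem exists_colength_frobeniusPower_add_le (p : ℕ) [Fact p.Prime] {R : Type*} [CommRing R]
    [IsLocalRing R] [CharP R p] [IsNoetherianRing R] [IsDomain R] (hF : (frobenius R p).Finite)
    (f : ℕ) : ∃ D : ℕ, ∀ e : ℕ,
      colength (frobeniusPower R p (e + f)) * FrobPush.residueDegree p R ^ f * p ^ e ≤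
        Module.finrank R (FrobPush p f R) * colength (frobeniusPower R p e) * p ^ e +
          D * (p ^ e) ^ krullDimNat R := by
  have hfin := FrobPush.module_finite p f hF
  obtain ⟨g, -, c, hc, hg⟩ := exists_linearIndependent_smul_mem_span R (FrobPush p f R)
  rw [← Fintype.range_linearCombination] at hg
  obtain ⟨D, hD⟩ := exists_length_quotient_mul_le_add p (Fintype.linearCombination R g)
    (mem_nonZeroDivisors_of_ne_zero hc) hg
  refine ⟨D, fun e => ?_⟩
  have hsmul : ∀ r ∈ frobeniusPower R p e, ∀ m : FrobPush p f R,
      r • m ∈ FrobPush.submodule p f (frobeniusPower R p (e + f)) := by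
    intro r hr m
    obtain ⟨m, rfl⟩ := (FrobPush.of p f).surjective m
    rw [FrobPush.smul_of, FrobPush.of_mem_submodule]
    exact Ideal.mul_mem_right _ _ (pow_mem_frobeniusPower_add f hr)
  have hcomap : (Submodule.pi Set.univ fun _ => frobeniusPower R p e) ≤
      (FrobPush.submodule p f (frobeniusPower R p (e + f))).comap
        (Fintype.linearCombination R g) := fun m hm => by
    rw [Submodule.mem_comap, Fintype.linearCombination_apply]
    exact Submodule.sum_mem _ fun i _ => hsmul _ (hm i trivial) _
  have hle := hD e hcomap (Submodule.smul_le.2 fun r hr m _ => hsmul r hr m)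
  rw [length_quotient_pi_ideal, FrobPush.length_quotient p f hF,
    ← coe_colength p (le_refl (frobeniusPower R p e)),
    ← coe_colength p (le_refl (frobeniusPower R p (e + f)))] at hle
  exact_mod_cast hle

/-! ### Convergence of sequences -/

theorem tendsto_zero_of_le_mul_add {x ε : ℕ → ℝ} (hx : ∀ e, 0 ≤ x e) (hB : BddAbove (Set.range x))
    {θ : ℝ} (hθ₀ : 0 ≤ θ) (hθ₁ : θ < 1) (hε : Tendsto ε atTop (𝓝 0)) {f : ℕ}
    (h : ∀ e, x (e + f) ≤ θ * x e + ε e) : Tendsto x atTop (𝓝 0) := by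
  have hle : IsBoundedUnder (· ≤ ·) atTop x := hB.isBoundedUnder_of_range
  have hge : IsBoundedUnder (· ≥ ·) atTop x := isBoundedUnder_of ⟨0, hx⟩
  set L := limsup x atTop
  have hL_le (δ : ℝ) (hδ : 0 < δ) : L ≤ θ * L + 2 * δ := by
    have hev : ∀ᶠ e in atTop, x (e + f) ≤ θ * L + 2 * δ := by
      filter_upwards [eventually_lt_of_limsup_lt (lt_add_of_pos_right L hδ) hle,
        hε.eventually_le_const hδ] with e hxe hεe
      nlinarith [h e]
    refine (limsup_nat_add x f).symm.trans_le ?_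
    refine limsup_le_of_le (IsBoundedUnder.isCoboundedUnder_le ?_) hev
    exact isBoundedUnder_of ⟨0, fun e => hx (e + f)⟩
  have hL_nonpos : L ≤ 0 := by
    by_contra! hpos
    have := hL_le ((1 - θ) * L / 4) (by have := mul_pos (sub_pos.2 hθ₁) hpos; linarith)
    linarith [mul_pos (sub_pos.2 hθ₁) hpos]
  exact tendsto_of_le_liminf_of_limsup_le
    (le_liminf_of_le hle.isCoboundedUnder_ge (.of_forall hx)) hL_nonpos hle hge

theorem exists_tendsto_of_forall_le_add {u : ℕ → ℝ} (hu : BddAbove (Set.range u)) {m : ℕ}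
    (h : ∀ k ≥ m, ∀ j, u j ≤ u (j + k)) : ∃ s, Tendsto u atTop (𝓝 s) := by
  refine ⟨⨆ j, u j, tendsto_order.2 ⟨fun a ha => ?_, fun a ha => ?_⟩⟩
  · obtain ⟨j, hj⟩ := exists_lt_of_lt_ciSup ha
    filter_upwards [eventually_ge_atTop (j + m)] with i hi
    obtain ⟨k, rfl⟩ := Nat.exists_eq_add_of_le (le_of_add_le_left hi)
    exact hj.trans_le (h k (Nat.le_of_add_le_add_left hi) j)
  · exact .of_forall fun i => (le_ciSup hu i).trans_lt ha

theorem exists_tendsto_of_forall_le_add_summable {u : ℕ → ℝ} (hu : BddAbove (Set.range u)) {m : ℕ}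
    (hm : 0 < m) (h : ∀ k ∈ Finset.Ico m (2 * m), ∃ ε : ℕ → ℝ, Summable ε ∧ (∀ j, 0 ≤ ε j) ∧
      ∀ j, u j ≤ u (j + k) + ε j) : ∃ s, Tendsto u atTop (𝓝 s) := by
  choose! ε hsum hnonneg hle using h
  let E (j : ℕ) : ℝ := ∑ k ∈ Finset.Ico m (2 * m), ε k j
  have hE : Summable E := summable_sum hsum
  have hE_nonneg (j : ℕ) : 0 ≤ E j := Finset.sum_nonneg fun k hk => hnonneg k hk j
  -- Subtracting the tails of the error terms makes the sequence increase along `[m, 2m)`.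
  let t (j : ℕ) : ℝ := ∑' i, E (i + j)
  have ht_nonneg (j : ℕ) : 0 ≤ t j := tsum_nonneg fun i => hE_nonneg (i + j)
  have ht (j : ℕ) {k : ℕ} (hk : 0 < k) : E j + t (j + k) ≤ t j := by
    have hEj : E j ≤ ∑ i ∈ Finset.range k, E (i + j) := by
      simpa only [zero_add] using Finset.single_le_sum (f := fun i => E (i + j))
        (fun i _ => hE_nonneg _) (Finset.mem_range.2 hk)
    have := ((summable_nat_add_iff j).2 hE).sum_add_tsum_nat_add k
    simp only [t, ← add_assoc, add_right_comm _ k j] at this ⊢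
    linarith
  have hstep : ∀ k ∈ Finset.Ico m (2 * m), ∀ j, u j - t j ≤ u (j + k) - t (j + k) := by
    intro k hk j
    have hε : ε k j ≤ E j := Finset.single_le_sum (fun k hk => hnonneg k hk j) hk
    linarith [hle k hk j, ht j (hm.trans_le (Finset.mem_Ico.1 hk).1)]
  have hmono : ∀ k ≥ m, ∀ j, u j - t j ≤ u (j + k) - t (j + k) := by
    intro k
    induction k using Nat.strong_induction_on with
    | _ k ih =>
      intro hk j
      by_cases hk2 : k < 2 * m
      · exact hstep k (Finset.mem_Ico.2 ⟨hk, hk2⟩) j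
      · have := hstep m (Finset.mem_Ico.2 ⟨le_rfl, by omega⟩) (j + (k - m))
        rw [add_assoc, Nat.sub_add_cancel hk] at this
        exact (ih (k - m) (by omega) (by omega) j).trans this
  obtain ⟨s, hs⟩ := exists_tendsto_of_forall_le_add
    (hu.range_mono _ fun j => sub_le_self (u j) (ht_nonneg j)) hmono
  exact ⟨s, by simpa only [t, sub_add_cancel, add_zero] using hs.add (tendsto_sum_nat_add E)⟩

/-! ### Rings with zero divisors -/

theorem exists_mem_sup_annihilator_nonZeroDivisors {R : Type*} [CommRing R] [IsNoetherianRing R]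
    [IsReduced R] (I : Ideal R) : ∃ c ∈ I ⊔ I.annihilator, c ∈ nonZeroDivisors R := by
  by_contra! hcon
  obtain ⟨z, hz, hz0⟩ := SetLike.exists_of_lt
    (Ideal.bot_lt_annihilator_of_disjoint_nonZeroDivisors (Set.disjoint_left.2 hcon))
  have hmul (w : R) (hw : w ∈ I ⊔ I.annihilator) : z * w = 0 := Submodule.mem_annihilator.1 hz w hw
  have hzI : z ∈ I.annihilator :=
    Submodule.mem_annihilator.2 fun w hw => hmul w (Ideal.mem_sup_left hw)
  exact hz0 (IsReduced.eq_zero z ⟨2, by rw [sq, hmul z (Ideal.mem_sup_right hzI)]⟩)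

theorem exists_ne_bot_annihilator_ne_bot {R : Type*} [CommRing R] [Nontrivial R]
    (h : ¬ IsDomain R) : ∃ I : Ideal R, I ≠ ⊥ ∧ I.annihilator ≠ ⊥ := by
  obtain ⟨x, y, hxy, hx, hy⟩ : ∃ x y : R, x * y = 0 ∧ x ≠ 0 ∧ y ≠ 0 := by
    by_contra! hcon
    have : NoZeroDivisors R := ⟨fun {a b} hab => or_iff_not_imp_left.2 (hcon a b hab)⟩
    exact h (NoZeroDivisors.to_isDomain R)
  refine ⟨Ideal.span {x}, mt Ideal.span_singleton_eq_bot.1 hx,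
    (Submodule.ne_bot_iff _).2 ⟨y, ?_, hy⟩⟩
  rw [Submodule.mem_annihilator_span_singleton, smul_eq_mul, mul_comm, hxy]

namespace CartierModule

section ZeroDivisors

variable {p : ℕ} [Fact p.Prime] {R : Type u} [CommRing R] {C : CartierAlgebra.{u, w} p R}
  (ρ : CartierModule C R)

theorem act_mem_annihilator (Z : Ideal R) {e : ℕ} (x : C.deg e) {r : R} (hr : r ∈ Z.annihilator) :
    ρ.act e x r ∈ Z.annihilator := by
  rw [Submodule.mem_annihilator] at hr ⊢
  intro z hz
  have hq : p ^ e ≠ 0 := pow_ne_zero e (Fact.out : p.Prime).ne_zero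
  rw [smul_eq_mul, mul_comm, ← smul_eq_mul, ← ρ.isCartierLinear, smul_eq_mul, mul_comm,
    ← smul_eq_mul, hr _ (Z.pow_mem_of_mem hz _ (Nat.pos_of_ne_zero hq)), map_zero]

variable [IsLocalRing R]

theorem annihilator_le_splitIdeal {Z : Ideal R} (hZ : Z ≠ ⊥) (e : ℕ) :
    Z.annihilator ≤ ρ.splitIdeal e := fun _ hr x =>
  le_maximalIdeal (mt Submodule.annihilator_eq_top_iff.1 hZ) (ρ.act_mem_annihilator Z x hr)

theorem isReduced_of_splitIdeal_ne_top {f : ℕ} (hf : f ≠ 0) (h : ρ.splitIdeal f ≠ ⊤) :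
    IsReduced R := by
  refine (isReduced_iff_pow_one_lt (p ^ f) (Nat.one_lt_pow hf (Fact.out : p.Prime).one_lt)).2
    fun r hr => ?_
  obtain ⟨x, s, hx⟩ := ρ.exists_act_eq_one h
  have hlin := ρ.isCartierLinear x r s
  rw [hr, zero_smul, map_zero, hx, smul_eq_mul, mul_one] at hlin
  exact hlin.symm

theorem exists_colength_splitIdeal_mul_le [CharP R p] [IsNoetherianRing R] {f : ℕ} (hf : f ≠ 0)
    (hsplit : ρ.splitIdeal f ≠ ⊤) (hdom : ¬ IsDomain R) :
    ∃ D : ℕ, ∀ e : ℕ, colength (ρ.splitIdeal e) * p ^ e ≤ D * (p ^ e) ^ krullDimNat R := by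
  have := ρ.isReduced_of_splitIdeal_ne_top hf hsplit
  obtain ⟨I, hI, hI'⟩ := exists_ne_bot_annihilator_ne_bot hdom
  obtain ⟨c, hcI, hc⟩ := exists_mem_sup_annihilator_nonZeroDivisors I.annihilator
  have hc_mem (e : ℕ) : c ∈ ρ.splitIdeal e :=
    sup_le (ρ.annihilator_le_splitIdeal hI e) (ρ.annihilator_le_splitIdeal hI' e) hcI
  obtain ⟨D, hD⟩ := exists_length_quotient_mul_le_add p (LinearMap.mulLeft R c) hc
    fun y => ⟨y, rfl⟩
  refine ⟨D, fun e => ?_⟩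
  have hle := hD e (M' := ⊤) (P' := ρ.splitIdeal e) (fun r _ => Ideal.mul_mem_right _ _ (hc_mem e))
    (by rw [smul_eq_mul, Ideal.mul_top]; exact ρ.frobeniusPower_le_splitIdeal e)
  rw [Module.length_eq_zero (M := R ⧸ (⊤ : Submodule R R)), zero_mul, zero_add,
    ← coe_colength p (ρ.frobeniusPower_le_splitIdeal e)] at hle
  exact_mod_cast hle

end ZeroDivisors

/-! ### The period -/

variable {p : ℕ} {R : Type u} [CommRing R] [IsLocalRing R] {C : CartierAlgebra.{u, w} p R}
  (ρ : CartierModule C R)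

theorem splitIdeal_zero_ne_top : ρ.splitIdeal 0 ≠ ⊤ := by
  rw [Ideal.ne_top_iff_one]
  intro h
  have hone := h (C.coeff 1)
  rw [ρ.act_coeff, one_smul] at hone
  exact (Ideal.ne_top_iff_one _).1 Ideal.IsPrime.ne_top' hone

theorem splittingPeriod_eq_setGcd :
    ρ.splittingPeriod = Nat.setGcd {e | ρ.splittingNumber e ≠ 0} := by
  have h : {d : ℕ | ∀ e : ℕ, ρ.splittingNumber e ≠ 0 → d ∣ e} =
      {d | d ∣ Nat.setGcd {e | ρ.splittingNumber e ≠ 0}} := by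
    ext d
    exact (Nat.dvd_setGcd_iff (s := {e | ρ.splittingNumber e ≠ 0})).symm
  rw [splittingPeriod, h]
  rcases Nat.eq_zero_or_pos (Nat.setGcd {e | ρ.splittingNumber e ≠ 0}) with h0 | hpos
  · rw [h0]
    refine Nat.sSup_of_not_bddAbove fun ⟨B, hB⟩ => ?_
    exact absurd (hB (show B + 1 ∣ 0 from dvd_zero _)) (by omega)
  · refine le_antisymm (csSup_le ⟨_, dvd_rfl⟩ fun d hd => Nat.le_of_dvd hpos hd)
      (le_csSup ⟨_, fun d hd => Nat.le_of_dvd hpos hd⟩ dvd_rfl)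

variable [Fact p.Prime] [CharP R p] [IsNoetherianRing R]

theorem exists_splitIdeal_mul_period_ne_top (hF : (frobenius R p).Finite) :
    ∃ m, ∀ k ≥ m, ρ.splitIdeal (k * ρ.splittingPeriod) ≠ ⊤ := by
  obtain ⟨m, hm⟩ := Nat.exists_mem_closure_of_ge {e | ρ.splittingNumber e ≠ 0}
  rw [← splittingPeriod_eq_setGcd] at hm
  have hclosure : ∀ e ∈ AddSubmonoid.closure {e | ρ.splittingNumber e ≠ 0},
      ρ.splitIdeal e ≠ ⊤ := by
    intro e he
    induction he using AddSubmonoid.closure_induction with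
    | mem e he => exact (ρ.splittingNumber_ne_zero_iff hF e).1 he
    | zero => exact ρ.splitIdeal_zero_ne_top
    | add e f _ _ he hf => exact ρ.splitIdeal_add_ne_top he hf
  refine ⟨m, fun k hk => ?_⟩
  rcases Nat.eq_zero_or_pos ρ.splittingPeriod with hn | hn
  · rw [hn, mul_zero]; exact ρ.splitIdeal_zero_ne_top
  · exact hclosure _ (hm _ (hk.trans (Nat.le_mul_of_pos_right k hn)) (dvd_mul_left _ _))

theorem exists_splitIdeal_ne_top (hF : (frobenius R p).Finite) (hn : ρ.splittingPeriod ≠ 0) :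
    ∃ f ≠ 0, ρ.splitIdeal f ≠ ⊤ := by
  obtain ⟨m, hm⟩ := ρ.exists_splitIdeal_mul_period_ne_top hF
  exact ⟨(m + 1) * ρ.splittingPeriod, mul_ne_zero m.succ_ne_zero hn, hm (m + 1) m.le_succ⟩

end CartierModule

/-! ### Existence of the limit -/

/-- The quotient `l / q ^ d` with `q = p ^ e` and `d = dim R`; the `F`-signature is a limit of such
quotients for the colengths `l` of the splitting ideals. -/
def normalizedLength (p : ℕ) (R : Type*) [CommRing R] (e l : ℕ) : ℝ :=
  l / ((p : ℝ) ^ e) ^ krullDimNat R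

/-- The number `[k^{1/p} : k]^f p^{f dim R}`. By Kunz it is the rank of `F^f_* R` for an `F`-finite
domain `R`. -/
def expectedRank (p : ℕ) (R : Type*) [CommRing R] [IsLocalRing R] (f : ℕ) : ℕ :=
  FrobPush.residueDegree p R ^ f * (p ^ f) ^ krullDimNat R

section NormalizedLength

variable (p : ℕ) (R : Type*) [CommRing R]

theorem normalizedLength_nonneg (e l : ℕ) : 0 ≤ normalizedLength p R e l := by
  unfold normalizedLength; positivity

theorem normalizedLength_mono {e l m : ℕ} (h : l ≤ m) :
    normalizedLength p R e l ≤ normalizedLength p R e m := by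
  unfold normalizedLength; gcongr

theorem normalizedLength_mul (e m l : ℕ) :
    normalizedLength p R e (m * l) = m * normalizedLength p R e l := by
  rw [normalizedLength, normalizedLength, Nat.cast_mul, mul_div_assoc]

variable [Fact p.Prime]

theorem normalizedLength_le {e l D : ℕ} (h : l ≤ D * (p ^ e) ^ krullDimNat R) :
    normalizedLength p R e l ≤ D := by
  have hp : (0 : ℝ) < p := by exact_mod_cast (Fact.out : p.Prime).pos
  rw [normalizedLength, div_le_iff₀ (by positivity)]
  exact_mod_cast h

theorem normalizedLength_le_add {e l m D : ℕ}
    (h : l * p ^ e ≤ m * p ^ e + D * (p ^ e) ^ krullDimNat R) :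
    normalizedLength p R e l ≤ normalizedLength p R e m + D / (p : ℝ) ^ e := by
  have hp : (0 : ℝ) < p := by exact_mod_cast (Fact.out : p.Prime).pos
  have h' : (l * p ^ e : ℝ) ≤ m * p ^ e + D * (p ^ e) ^ krullDimNat R := by exact_mod_cast h
  rw [← mul_le_mul_iff_left₀ (show 0 < (p : ℝ) ^ e * ((p : ℝ) ^ e) ^ krullDimNat R by positivity)]
  simp only [normalizedLength]
  field_simp
  linarith

theorem residueDegree_pow_mul_normalizedLength [IsLocalRing R] (e f l : ℕ) :
    FrobPush.residueDegree p R ^ f * normalizedLength p R e l =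
      expectedRank p R f * normalizedLength p R (e + f) l := by
  have hp : (0 : ℝ) < p := by exact_mod_cast (Fact.out : p.Prime).pos
  rw [normalizedLength, normalizedLength, expectedRank]
  push_cast
  rw [pow_add, mul_pow]
  field_simp

theorem tendsto_div_prime_pow (D : ℝ) : Tendsto (fun e : ℕ => D / (p : ℝ) ^ e) atTop (𝓝 0) :=
  tendsto_const_nhds.div_atTop (tendsto_pow_atTop_atTop_of_one_lt
    (by exact_mod_cast (Fact.out : p.Prime).one_lt))

theorem summable_div_prime_pow_mul (D : ℝ) {n : ℕ} (hn : n ≠ 0) :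
    Summable fun j : ℕ => D / (p : ℝ) ^ (j * n) := by
  have hp : (1 : ℝ) < (p : ℝ) ^ n :=
    one_lt_pow₀ (by exact_mod_cast (Fact.out : p.Prime).one_lt) hn
  have := (summable_geometric_of_lt_one (by positivity) (inv_lt_one_of_one_lt₀ hp)).mul_left D
  simpa only [div_eq_mul_inv, mul_comm _ n, pow_mul, inv_pow] using this

end NormalizedLength

section FFinite

variable {p : ℕ} [Fact p.Prime] {R : Type*} [CommRing R] [IsLocalRing R] [CharP R p]

theorem expectedRank_pos (hF : (frobenius R p).Finite) (f : ℕ) : 0 < expectedRank p R f :=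
  Nat.mul_pos (pow_pos (FrobPush.residueDegree_pos p hF) f)
    (pow_pos (pow_pos (Fact.out : p.Prime).pos f) _)

theorem prime_pow_rpow_fSigExponent (hF : (frobenius R p).Finite) (e : ℕ) :
    ((p : ℝ) ^ e) ^ fSigExponent p R =
      ((p : ℝ) ^ e) ^ krullDimNat R * (FrobPush.residueDegree p R : ℝ) ^ e := by
  have hp : (1 : ℝ) < p := by exact_mod_cast (Fact.out : p.Prime).one_lt
  have hp₀ : (0 : ℝ) < p := zero_lt_one.trans hp
  have hA : (0 : ℝ) < FrobPush.residueDegree p R := by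
    exact_mod_cast FrobPush.residueDegree_pos p hF
  have hδ : fSigExponent p R = (krullDimNat R : ℝ) + Real.logb p (FrobPush.residueDegree p R) :=
    rfl
  rw [hδ, Real.rpow_add (pow_pos hp₀ e), Real.rpow_natCast]
  congr 1
  rw [← Real.rpow_natCast (p : ℝ) e, ← Real.rpow_mul hp₀.le, mul_comm, Real.rpow_mul hp₀.le,
    Real.rpow_logb hp₀ hp.ne' hA, Real.rpow_natCast]

variable [IsNoetherianRing R]

variable (p R) in
theorem exists_normalizedLength_colength_le : ∃ B : ℝ, ∀ (e : ℕ) (I : Ideal R),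
    frobeniusPower R p e ≤ I → normalizedLength p R e (colength I) ≤ B := by
  obtain ⟨D, hD⟩ := exists_length_quotient_le_of_frobeniusPower_le (R := R) p
  refine ⟨D, fun e I hI => normalizedLength_le p R ?_⟩
  have := hD e I hI
  rw [← coe_colength p hI] at this
  exact_mod_cast this

theorem tendsto_normalizedLength_frobeniusPower_of_finrank_lt [IsDomain R]
    (hF : (frobenius R p).Finite) {f : ℕ}
    (hlt : Module.finrank R (FrobPush p f R) < expectedRank p R f) :
    Tendsto (fun e => normalizedLength p R e (colength (frobeniusPower R p e))) atTop (𝓝 0) := by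
  obtain ⟨B, hB⟩ := exists_normalizedLength_colength_le p R
  obtain ⟨D, hD⟩ := exists_colength_frobeniusPower_add_le p hF f
  have hq : (0 : ℝ) < expectedRank p R f := by exact_mod_cast expectedRank_pos hF f
  refine tendsto_zero_of_le_mul_add (f := f)
    (θ := Module.finrank R (FrobPush p f R) / expectedRank p R f)
    (ε := fun e => D / (p : ℝ) ^ e / expectedRank p R f)
    (fun e => normalizedLength_nonneg p R e _) ⟨B, Set.forall_mem_range.2 fun e => hB e _ le_rfl⟩
    (by positivity) ((div_lt_one hq).2 (by exact_mod_cast hlt))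
    (by simpa only [zero_div] using (tendsto_div_prime_pow p (D : ℝ)).div_const _) fun e => ?_
  have hle := normalizedLength_le_add p R (hD e)
  rw [mul_comm (colength _), normalizedLength_mul, normalizedLength_mul, Nat.cast_pow,
    residueDegree_pow_mul_normalizedLength] at hle
  rw [div_mul_eq_mul_div, ← add_div, le_div_iff₀ hq, mul_comm]
  exact hle

end FFinite

namespace CartierModule

variable {p : ℕ} [Fact p.Prime] {R : Type u} [CommRing R] [IsLocalRing R] [CharP R p]
  {C : CartierAlgebra.{u, w} p R} (ρ : CartierModule C R) [IsNoetherianRing R]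

theorem colength_splitIdeal_le_colength_frobeniusPower (e : ℕ) :
    colength (ρ.splitIdeal e) ≤ colength (frobeniusPower R p e) := by
  have hle := ρ.frobeniusPower_le_splitIdeal e
  have := length_quotient_anti (M := R) hle
  rw [← coe_colength p hle, ← coe_colength p (le_refl (frobeniusPower R p e))] at this
  exact_mod_cast this

theorem exists_normalizedLength_splitIdeal_le_add [IsDomain R] (hF : (frobenius R p).Finite)
    {f : ℕ} (hf : ρ.splitIdeal f ≠ ⊤)
    (hle : expectedRank p R f ≤ Module.finrank R (FrobPush p f R)) :
    ∃ D : ℝ, 0 ≤ D ∧ ∀ e, normalizedLength p R e (colength (ρ.splitIdeal e)) ≤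
      normalizedLength p R (e + f) (colength (ρ.splitIdeal (e + f))) + D / (p : ℝ) ^ e := by
  obtain ⟨D, hD⟩ := ρ.exists_rank_mul_colength_le hF hf
  have hq : (0 : ℝ) < expectedRank p R f := by exact_mod_cast expectedRank_pos hF f
  refine ⟨D / expectedRank p R f, by positivity, fun e => le_of_mul_le_mul_left ?_ hq⟩
  have hrank := normalizedLength_le_add p R (hD e)
  rw [mul_comm (colength _), normalizedLength_mul, normalizedLength_mul, Nat.cast_pow,
    residueDegree_pow_mul_normalizedLength] at hrank
  calc _ ≤ _ := mul_le_mul_of_nonneg_right (by exact_mod_cast hle) (normalizedLength_nonneg p R e _)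
    _ ≤ _ := hrank
    _ = _ := by field_simp

theorem tendsto_normalizedLength_of_not_isDomain (hF : (frobenius R p).Finite)
    (hn : ρ.splittingPeriod ≠ 0) (hdom : ¬ IsDomain R) :
    Tendsto (fun e => normalizedLength p R e (colength (ρ.splitIdeal e))) atTop (𝓝 0) := by
  obtain ⟨f, hf, hsplit⟩ := ρ.exists_splitIdeal_ne_top hF hn
  obtain ⟨D, hD⟩ := ρ.exists_colength_splitIdeal_mul_le hf hsplit hdom
  refine squeeze_zero (fun e => normalizedLength_nonneg p R e _) (fun e => ?_)
    (tendsto_div_prime_pow p D)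
  have hle := normalizedLength_le_add p R (m := 0) ((hD e).trans le_add_self)
  rwa [normalizedLength, normalizedLength, Nat.cast_zero, zero_div, zero_add] at hle

theorem exists_tendsto_normalizedLength_of_isDomain [IsDomain R] (hF : (frobenius R p).Finite)
    (hn : ρ.splittingPeriod ≠ 0) :
    ∃ s, Tendsto (fun j => normalizedLength p R (j * ρ.splittingPeriod)
      (colength (ρ.splitIdeal (j * ρ.splittingPeriod)))) atTop (𝓝 s) := by
  by_cases hrank : ∃ f, Module.finrank R (FrobPush p f R) < expectedRank p R f
  · obtain ⟨f, hlt⟩ := hrank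
    have hzero : Tendsto (fun e => normalizedLength p R e (colength (ρ.splitIdeal e)))
        atTop (𝓝 0) :=
      squeeze_zero (fun e => normalizedLength_nonneg p R e _)
        (fun e => normalizedLength_mono p R (ρ.colength_splitIdeal_le_colength_frobeniusPower e))
        (tendsto_normalizedLength_frobeniusPower_of_finrank_lt hF hlt)
    exact ⟨0, hzero.comp (tendsto_id.atTop_mul_const' (Nat.pos_of_ne_zero hn))⟩
  · push Not at hrank
    obtain ⟨m, hm⟩ := ρ.exists_splitIdeal_mul_period_ne_top hF
    obtain ⟨B, hB⟩ := exists_normalizedLength_colength_le p R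
    refine exists_tendsto_of_forall_le_add_summable
      ⟨B, Set.forall_mem_range.2 fun j => hB _ _ (ρ.frobeniusPower_le_splitIdeal _)⟩
      m.succ_pos fun k hk => ?_
    obtain ⟨D, hD₀, hD⟩ := ρ.exists_normalizedLength_splitIdeal_le_add hF
      (hm k (m.le_succ.trans (Finset.mem_Ico.1 hk).1)) (hrank _)
    refine ⟨fun j => D / (p : ℝ) ^ (j * ρ.splittingPeriod), summable_div_prime_pow_mul p D hn,
      fun j => by positivity, fun j => ?_⟩
    rw [add_mul]
    exact hD _

theorem splittingNumber_div_eq (hF : (frobenius R p).Finite) (e : ℕ) :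
    (ρ.splittingNumber e : ℝ) / ((p : ℝ) ^ e) ^ fSigExponent p R =
      normalizedLength p R e (colength (ρ.splitIdeal e)) := by
  have hA : (FrobPush.residueDegree p R : ℝ) ^ e ≠ 0 :=
    pow_ne_zero e (by exact_mod_cast (FrobPush.residueDegree_pos p hF).ne')
  rw [prime_pow_rpow_fSigExponent hF, ρ.splittingNumber_eq hF, normalizedLength]
  push_cast
  exact mul_div_mul_right _ _ hA

theorem hasFSignature_iff_tendsto (hF : (frobenius R p).Finite) (hn : ρ.splittingPeriod ≠ 0)
    {s : ℝ} : ρ.HasFSignature s ↔ Tendsto (fun j => normalizedLength p R (j * ρ.splittingPeriod)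
      (colength (ρ.splitIdeal (j * ρ.splittingPeriod)))) atTop (𝓝 s) := by
  rw [HasFSignature, if_neg hn]
  simp only [ρ.splittingNumber_div_eq hF]

end CartierModule

/-! ### Finite local extensions -/

theorem ringKrullDim_eq_of_isIntegral_of_injective (R S : Type*) [CommRing R] [CommRing S]
    [Algebra R S] [Algebra.IsIntegral R S] (h : Function.Injective (algebraMap R S)) :
    ringKrullDim S = ringKrullDim R := by
  apply le_antisymm
  · exact Order.krullDim_le_of_strictMono (PrimeSpectrum.comap (algebraMap R S)) fun P Q hPQ =>
      Ideal.IsIntegral.comap_lt_comap (R := R) (I := P.asIdeal) (J := Q.asIdeal) hPQ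
  · have := (faithfulSMul_iff_algebraMap_injective R S).2 h
    refine iSup_le fun l => ?_
    obtain ⟨P, hP, hPl⟩ := Ideal.nonempty_primesOver (S := S) l.head.asIdeal
    obtain ⟨L, hL, -, -⟩ := Ideal.exists_ltSeries_of_hasGoingUp l P
    rw [← hL]
    exact le_iSup (fun l : LTSeries (PrimeSpectrum S) => (l.length : WithBot ℕ∞)) L

theorem frobenius_finite_of_finite {p : ℕ} [Fact p.Prime] {R S : Type*} [CommRing R]
    [CharP R p] [CommRing S] [CharP S p] [Algebra R S] [Module.Finite R S]
    (hF : (frobenius R p).Finite) : (frobenius S p).Finite := by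
  have hcomm : (frobenius S p).comp (algebraMap R S) = (algebraMap R S).comp (frobenius R p) :=
    RingHom.ext fun r => ((algebraMap R S).map_frobenius p r).symm
  refine RingHom.Finite.of_comp_finite (f := algebraMap R S) ?_
  rw [hcomm]
  exact (RingHom.finite_algebraMap.2 inferInstance).comp hF

theorem finrank_fractionRing_tensorProduct (R S : Type*) [CommRing R] [CommRing S] [Algebra R S] :
    Module.finrank (FractionRing R) (FractionRing R ⊗[R] S) = Module.finrank R S := by
  rw [IsFractionRing.finrank_right_eq R (S := FractionRing R) (N := FractionRing R ⊗[R] S)]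
  exact IsLocalizedModule.finrank_eq (nonZeroDivisors R)
    (TensorProduct.mk R (FractionRing R) S 1) le_rfl

theorem length_quotient_restrictScalars (p : ℕ) [Fact p.Prime] (R : Type*) [CommRing R]
    [IsLocalRing R] {S : Type*} [CommRing S] [IsLocalRing S] [IsNoetherianRing S] [CharP S p]
    [Algebra R S] [IsLocalHom (algebraMap R S)] [Module.Finite R S] {e : ℕ} {I : Ideal S}
    (hI : frobeniusPower S p e ≤ I) : Module.length R (S ⧸ I.restrictScalars R) =
      (Module.finrank (ResidueField R) (ResidueField S) * colength I : ℕ) := by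
  rw [(Submodule.Quotient.restrictScalarsEquiv R I).length_eq, length_restrictScalars R S (S ⧸ I),
    Module.length_eq_finrank, ← coe_colength p hI, mul_comm, Nat.cast_mul]

theorem normalizedLength_finrank_mul (p : ℕ) {R S : Type*} [CommRing R] [IsLocalRing R]
    [CommRing S] [IsLocalRing S] [Algebra R S] [IsLocalHom (algebraMap R S)] [Module.Finite R S]
    (hRS : Function.Injective (algebraMap R S)) (e l : ℕ) :
    normalizedLength p R e (Module.finrank (ResidueField R) (ResidueField S) * l) =
      Module.finrank (ResidueField R) (ResidueField S) * normalizedLength p S e l := by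
  rw [normalizedLength_mul, normalizedLength, normalizedLength, krullDimNat, krullDimNat,
    ringKrullDim_eq_of_isIntegral_of_injective R S hRS]

/-! ### Transposition -/

section Transpose

variable {R : Type u} [CommRing R] {S : Type v} [CommRing S] [Algebra R S]
  {σ : S →ₗ[S] UpperShriek R S R}

theorem apply_eq_apply_one_mul (σ : S →ₗ[S] UpperShriek R S R) (s t : S) :
    σ s t = σ 1 (s * t) := by
  rw [← UpperShriek.smul_apply, ← map_smul, smul_eq_mul, mul_one]

/-- The `R`-bilinear form `(s, t) ↦ T(st)` on `S`, where `T = σ(1)`; it is the form behind `σ`. -/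
def mulForm (σ : S →ₗ[S] UpperShriek R S R) : S →ₗ[R] S →ₗ[R] R :=
  (LinearMap.mul R S).compr₂ (σ 1 : S →ₗ[R] R)

theorem mulForm_injective (hσ : Function.Injective σ) : Function.Injective (mulForm σ) :=
  fun s s' h => hσ <| UpperShriek.ext fun t => by
    rw [apply_eq_apply_one_mul, apply_eq_apply_one_mul σ s']
    exact LinearMap.congr_fun h t

theorem algebraMap_injective_of_surjective_apply_one (hsurj : Function.Surjective (σ 1)) :
    Function.Injective (algebraMap R S) := by
  refine (injective_iff_map_eq_zero _).2 fun r hr => ?_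
  obtain ⟨z, hz⟩ := hsurj 1
  rw [← mul_one r, ← smul_eq_mul, ← hz, ← map_smul, Algebra.smul_def, hr, zero_mul, map_zero]

variable {p : ℕ} [Fact p.Prime] [CharP R p] {C : CartierAlgebra.{u, w} p R}
  {ρ : CartierModule C R}

theorem apply_one_transpose_mul (hT : IsTransposable σ ρ) {e : ℕ} (x : C.deg e) (s t : S) :
    σ 1 (transpose hT x s * t) = ρ.act e x (σ 1 (s * t ^ p ^ e)) := by
  rw [← apply_eq_apply_one_mul, transpose_spec, apply_eq_apply_one_mul]

theorem apply_one_transpose (hT : IsTransposable σ ρ) {e : ℕ} (x : C.deg e) (s : S) :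
    σ 1 (transpose hT x s) = ρ.act e x (σ 1 s) := by
  simpa only [one_pow, mul_one] using apply_one_transpose_mul hT x s 1

theorem transposeModule_act_tmul (hσ : Function.Injective σ) (hT : IsTransposable σ ρ) {e : ℕ}
    (x : C.deg e) (s t : S) :
    (transposeModule hσ hT).act e (x ⊗ₜ[R] s : C.deg e ⊗[R] S) t = transpose hT x (s * t) := rfl

theorem transposeModule_act_mem (hσ : Function.Injective σ) (hT : IsTransposable σ ρ)
    {e : ℕ} {H : AddSubgroup S} {t : S} (h : ∀ (x : C.deg e) (s : S), transpose hT x (s * t) ∈ H)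
    (y : (C.pullback S).deg e) : (transposeModule hσ hT).act e y t ∈ H := by
  induction (show C.deg e ⊗[R] S from y) using TensorProduct.induction_on with
  | zero =>
    rw [show (transposeModule hσ hT).act e (0 : C.deg e ⊗[R] S) = 0 from map_zero _]
    exact H.zero_mem
  | tmul x s => exact h x s
  | add a b ha hb =>
    rw [show (transposeModule hσ hT).act e (a + b : C.deg e ⊗[R] S) =
      (transposeModule hσ hT).act e a + (transposeModule hσ hT).act e b from map_add _ _ _]
    exact H.add_mem ha hb

variable [IsLocalRing R] [IsLocalRing S]

theorem mem_maximalIdeal_of_forall_apply_one_mul (hsurj : Function.Surjective (σ 1)) {s : S}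
    (h : ∀ t, σ 1 (s * t) ∈ maximalIdeal R) : s ∈ maximalIdeal S := by
  by_contra hs
  rw [mem_maximalIdeal, mem_nonunits_iff, not_not] at hs
  obtain ⟨b, hb⟩ := hs.exists_right_inv
  obtain ⟨z, hz⟩ := hsurj 1
  have hone := h (b * z)
  rw [← mul_assoc, hb, one_mul, hz] at hone
  exact (Ideal.ne_top_iff_one _).1 Ideal.IsPrime.ne_top' hone

theorem mem_splitIdeal_transposeModule (hσ : Function.Injective σ)
    (hT : IsTransposable σ ρ) (hsurj : Function.Surjective (σ 1))
    (hmax : ∀ s ∈ maximalIdeal S, σ 1 s ∈ maximalIdeal R) {e : ℕ} {s : S} :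
    s ∈ (transposeModule hσ hT).splitIdeal e ↔ ∀ t, σ 1 (s * t) ∈ ρ.splitIdeal e := by
  constructor
  · intro h t x
    have hmem : transpose hT x (t * s) ∈ maximalIdeal S := h (x ⊗ₜ[R] t : C.deg e ⊗[R] S)
    rw [← apply_one_transpose hT, mul_comm]
    exact hmax _ hmem
  · intro h y
    refine transposeModule_act_mem hσ hT (H := (maximalIdeal S).toAddSubgroup) (fun x a => ?_) y
    refine mem_maximalIdeal_of_forall_apply_one_mul hsurj fun t => ?_
    rw [apply_one_transpose_mul, mul_comm a s, mul_assoc]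
    exact h _ x

theorem splitIdeal_transposeModule_eq_top_iff (hσ : Function.Injective σ)
    (hT : IsTransposable σ ρ) (hsurj : Function.Surjective (σ 1))
    (hmax : ∀ s ∈ maximalIdeal S, σ 1 s ∈ maximalIdeal R) (e : ℕ) :
    (transposeModule hσ hT).splitIdeal e = ⊤ ↔ ρ.splitIdeal e = ⊤ := by
  rw [Ideal.eq_top_iff_one, Ideal.eq_top_iff_one,
    mem_splitIdeal_transposeModule hσ hT hsurj hmax]
  simp only [one_mul]
  refine ⟨fun h => ?_, fun h t => (Ideal.eq_top_iff_one _).2 h ▸ Submodule.mem_top⟩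
  obtain ⟨z, hz⟩ := hsurj 1
  exact hz ▸ h z

theorem linearCombination_mem_splitIdeal (hσ : Function.Injective σ) (hT : IsTransposable σ ρ)
    (hsurj : Function.Surjective (σ 1)) (hmax : ∀ s ∈ maximalIdeal S, σ 1 s ∈ maximalIdeal R)
    {n : ℕ} (g : Fin n → S) (e : ℕ) :
    (Submodule.pi Set.univ fun _ => ρ.splitIdeal e) ≤
      (((transposeModule hσ hT).splitIdeal e).restrictScalars R).comap
        (Fintype.linearCombination R g) := by
  intro m hm
  rw [Submodule.mem_comap, Fintype.linearCombination_apply]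
  refine Submodule.sum_mem _ fun i _ => ?_
  rw [Submodule.restrictScalars_mem, mem_splitIdeal_transposeModule hσ hT hsurj hmax]
  intro t
  rw [smul_mul_assoc, map_smul]
  exact Ideal.mul_mem_right _ _ (hm i trivial)

variable [IsNoetherianRing R] [CharP S p] [Module.Finite R S]

theorem splittingPeriod_transposeModule (hF : (frobenius R p).Finite)
    (hσ : Function.Injective σ) (hT : IsTransposable σ ρ)
    (hsurj : Function.Surjective (σ 1)) (hmax : ∀ s ∈ maximalIdeal S, σ 1 s ∈ maximalIdeal R) :
    (transposeModule hσ hT).splittingPeriod = ρ.splittingPeriod := by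
  have : IsNoetherianRing S := IsNoetherianRing.of_finite R S
  simp only [CartierModule.splittingPeriod, ρ.splittingNumber_ne_zero_iff hF,
    (transposeModule hσ hT).splittingNumber_ne_zero_iff (frobenius_finite_of_finite hF), Ne,
    splitIdeal_transposeModule_eq_top_iff hσ hT hsurj hmax]

variable [IsLocalHom (algebraMap R S)]

theorem exists_colength_splitIdeal_transposeModule_le (hσ : Function.Injective σ)
    (hT : IsTransposable σ ρ) (hsurj : Function.Surjective (σ 1))
    (hmax : ∀ s ∈ maximalIdeal S, σ 1 s ∈ maximalIdeal R) :
    ∃ n : ℕ, ∀ e : ℕ, Module.finrank (ResidueField R) (ResidueField S) *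
      colength ((transposeModule hσ hT).splitIdeal e) ≤ n * colength (ρ.splitIdeal e) := by
  have : IsNoetherianRing S := IsNoetherianRing.of_finite R S
  obtain ⟨n, g, hg⟩ := Module.Finite.exists_fin (R := R) (M := S)
  refine ⟨n, fun e => ?_⟩
  have hle := length_quotient_le_add_sup_range (Fintype.linearCombination R g)
    (linearCombination_mem_splitIdeal hσ hT hsurj hmax g e)
  rw [Fintype.range_linearCombination, hg, sup_top_eq,
    Module.length_eq_zero (M := S ⧸ (⊤ : Submodule R S)), add_zero, length_quotient_pi_ideal,
    ← coe_colength p (ρ.frobeniusPower_le_splitIdeal e), length_quotient_restrictScalars p R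
      ((transposeModule hσ hT).frobeniusPower_le_splitIdeal e)] at hle
  exact_mod_cast hle

theorem exists_colength_splitIdeal_transposeModule_mul_le [IsDomain R]
    (hσ : Function.Injective σ) (hT : IsTransposable σ ρ) (hsurj : Function.Surjective (σ 1))
    (hmax : ∀ s ∈ maximalIdeal S, σ 1 s ∈ maximalIdeal R) :
    ∃ D : ℕ, ∀ e : ℕ, Module.finrank (ResidueField R) (ResidueField S) *
      colength ((transposeModule hσ hT).splitIdeal e) * p ^ e ≤
        Module.finrank R S * colength (ρ.splitIdeal e) * p ^ e + D * (p ^ e) ^ krullDimNat R := by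
  have : IsNoetherianRing S := IsNoetherianRing.of_finite R S
  obtain ⟨g, -, c, hc, hg⟩ := exists_linearIndependent_smul_mem_span R S
  rw [← Fintype.range_linearCombination] at hg
  obtain ⟨D, hD⟩ := exists_length_quotient_mul_le_add p (Fintype.linearCombination R g)
    (mem_nonZeroDivisors_of_ne_zero hc) hg
  refine ⟨D, fun e => ?_⟩
  have hsmul : frobeniusPower R p e • ⊤ ≤
      ((transposeModule hσ hT).splitIdeal e).restrictScalars R := by
    refine Submodule.smul_le.2 fun r hr s _ => ?_
    rw [Submodule.restrictScalars_mem, mem_splitIdeal_transposeModule hσ hT hsurj hmax]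
    intro t
    rw [smul_mul_assoc, map_smul]
    exact Ideal.mul_mem_right _ _ (ρ.frobeniusPower_le_splitIdeal e hr)
  have hle := hD e (linearCombination_mem_splitIdeal hσ hT hsurj hmax g e) hsmul
  rw [length_quotient_pi_ideal, ← coe_colength p (ρ.frobeniusPower_le_splitIdeal e),
    length_quotient_restrictScalars p R
      ((transposeModule hσ hT).frobeniusPower_le_splitIdeal e)] at hle
  exact_mod_cast hle

theorem exists_mul_le_colength_splitIdeal_transposeModule [IsDomain R]
    (hσ : Function.Injective σ) (hT : IsTransposable σ ρ) (hsurj : Function.Surjective (σ 1))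
    (hmax : ∀ s ∈ maximalIdeal S, σ 1 s ∈ maximalIdeal R) :
    ∃ D : ℕ, ∀ e : ℕ, Module.finrank R S * colength (ρ.splitIdeal e) * p ^ e ≤
      Module.finrank (ResidueField R) (ResidueField S) *
        colength ((transposeModule hσ hT).splitIdeal e) * p ^ e +
          D * (p ^ e) ^ krullDimNat R := by
  have : IsNoetherianRing S := IsNoetherianRing.of_finite R S
  obtain ⟨g, -, c, hc, hg⟩ := exists_linearIndependent_smul_mem_span R S
  obtain ⟨c', hc', hu⟩ := exists_smul_mem_range_pi_flip (mulForm_injective hσ) hc hg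
  obtain ⟨D, hD⟩ := exists_length_quotient_mul_le_add p
    (LinearMap.pi fun i => (mulForm σ).flip (g i)) (mem_nonZeroDivisors_of_ne_zero hc') hu
  refine ⟨D, fun e => ?_⟩
  have hcomap : ((transposeModule hσ hT).splitIdeal e).restrictScalars R ≤
      (Submodule.pi Set.univ fun _ => ρ.splitIdeal e).comap
        (LinearMap.pi fun i => (mulForm σ).flip (g i)) :=
    fun s hs i _ => (mem_splitIdeal_transposeModule hσ hT hsurj hmax).1 hs (g i)
  have hle := hD e hcomap (smul_top_le_pi_ideal _ (ρ.frobeniusPower_le_splitIdeal e))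
  rw [length_quotient_pi_ideal, ← coe_colength p (ρ.frobeniusPower_le_splitIdeal e),
    length_quotient_restrictScalars p R
      ((transposeModule hσ hT).frobeniusPower_le_splitIdeal e)] at hle
  exact_mod_cast hle

/-! ### The transformation rule for `F`-signatures -/

theorem tendsto_normalizedLength_sub_zero [IsDomain R]
    (hσ : Function.Injective σ) (hT : IsTransposable σ ρ) (hsurj : Function.Surjective (σ 1))
    (hmax : ∀ s ∈ maximalIdeal S, σ 1 s ∈ maximalIdeal R) :
    Tendsto (fun e => Module.finrank (ResidueField R) (ResidueField S) *
      normalizedLength p S e (colength ((transposeModule hσ hT).splitIdeal e)) -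
        Module.finrank R S * normalizedLength p R e (colength (ρ.splitIdeal e))) atTop (𝓝 0) := by
  obtain ⟨D, hD⟩ := exists_colength_splitIdeal_transposeModule_mul_le hσ hT hsurj hmax
  obtain ⟨D', hD'⟩ := exists_mul_le_colength_splitIdeal_transposeModule hσ hT hsurj hmax
  simp only [← normalizedLength_finrank_mul p (algebraMap_injective_of_surjective_apply_one hsurj),
    ← normalizedLength_mul]
  refine squeeze_zero_norm (a := fun e => D / (p : ℝ) ^ e + D' / (p : ℝ) ^ e) (fun e => ?_)
    (by simpa only [add_zero] using (tendsto_div_prime_pow p D).add (tendsto_div_prime_pow p D'))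
  have hle := normalizedLength_le_add p R (hD e)
  have hge := normalizedLength_le_add p R (hD' e)
  have hD₀ : (0 : ℝ) ≤ D / (p : ℝ) ^ e := by positivity
  have hD₀' : (0 : ℝ) ≤ D' / (p : ℝ) ^ e := by positivity
  rw [Real.norm_eq_abs, abs_le]
  constructor <;> linarith

theorem tendsto_normalizedLength_transposeModule_zero
    (hσ : Function.Injective σ) (hT : IsTransposable σ ρ) (hsurj : Function.Surjective (σ 1))
    (hmax : ∀ s ∈ maximalIdeal S, σ 1 s ∈ maximalIdeal R)
    (h : Tendsto (fun e => normalizedLength p R e (colength (ρ.splitIdeal e))) atTop (𝓝 0)) :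
    Tendsto (fun e => Module.finrank (ResidueField R) (ResidueField S) *
      normalizedLength p S e (colength ((transposeModule hσ hT).splitIdeal e))) atTop (𝓝 0) := by
  obtain ⟨n, hn⟩ := exists_colength_splitIdeal_transposeModule_le hσ hT hsurj hmax
  simp only [← normalizedLength_finrank_mul p (algebraMap_injective_of_surjective_apply_one hsurj)]
  refine squeeze_zero (fun e => normalizedLength_nonneg p R e _)
    (fun e => normalizedLength_mono p R (hn e)) ?_
  simp only [normalizedLength_mul]
  simpa only [mul_zero] using h.const_mul (n : ℝ)

theorem exists_tendsto_normalizedLength_transposeModule (hF : (frobenius R p).Finite)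
    (hσ : Function.Injective σ) (hT : IsTransposable σ ρ) (hsurj : Function.Surjective (σ 1))
    (hmax : ∀ s ∈ maximalIdeal S, σ 1 s ∈ maximalIdeal R) (hn : ρ.splittingPeriod ≠ 0) :
    ∃ s, Tendsto (fun j => normalizedLength p R (j * ρ.splittingPeriod)
        (colength (ρ.splitIdeal (j * ρ.splittingPeriod)))) atTop (𝓝 s) ∧
      Tendsto (fun j => Module.finrank (ResidueField R) (ResidueField S) *
        normalizedLength p S (j * ρ.splittingPeriod)
          (colength ((transposeModule hσ hT).splitIdeal (j * ρ.splittingPeriod)))) atTop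
        (𝓝 (Module.finrank (FractionRing R) (FractionRing R ⊗[R] S) * s)) := by
  have hmul : Tendsto (fun j : ℕ => j * ρ.splittingPeriod) atTop atTop :=
    tendsto_id.atTop_mul_const' (Nat.pos_of_ne_zero hn)
  by_cases hdom : IsDomain R
  · obtain ⟨s, hs⟩ := ρ.exists_tendsto_normalizedLength_of_isDomain hF hn
    refine ⟨s, hs, ?_⟩
    rw [finrank_fractionRing_tensorProduct]
    simpa only [Function.comp_def, sub_add_cancel, zero_add] using
      ((tendsto_normalizedLength_sub_zero hσ hT hsurj hmax).comp hmul).add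
        (hs.const_mul (Module.finrank R S : ℝ))
  · have hzero := ρ.tendsto_normalizedLength_of_not_isDomain hF hn hdom
    refine ⟨0, hzero.comp hmul, ?_⟩
    rw [mul_zero]
    exact (tendsto_normalizedLength_transposeModule_zero hσ hT hsurj hmax hzero).comp hmul

theorem exists_hasFSignature_transposeModule (hF : (frobenius R p).Finite)
    (hσ : Function.Injective σ) (hT : IsTransposable σ ρ)
    (hsurj : Function.Surjective (σ 1)) (hmax : ∀ s ∈ maximalIdeal S, σ 1 s ∈ maximalIdeal R) :
    ∃ sR sS : ℝ, ρ.HasFSignature sR ∧ (transposeModule hσ hT).HasFSignature sS ∧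
      (Module.finrank (ResidueField R) (ResidueField S) : ℝ) * sS =
        (Module.finrank (FractionRing R) (FractionRing R ⊗[R] S) : ℝ) * sR := by
  have : IsNoetherianRing S := IsNoetherianRing.of_finite R S
  have hperiod := splittingPeriod_transposeModule hF hσ hT hsurj hmax
  by_cases hn : ρ.splittingPeriod = 0
  · refine ⟨0, 0, ?_, ?_, by rw [mul_zero, mul_zero]⟩
    · rw [CartierModule.HasFSignature, if_pos hn]
    · rw [CartierModule.HasFSignature, if_pos (hperiod.trans hn)]
  have hdeg : (Module.finrank (ResidueField R) (ResidueField S) : ℝ) ≠ 0 :=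
    Nat.cast_ne_zero.2 Module.finrank_pos.ne'
  obtain ⟨s, hsR, hsS⟩ :=
    exists_tendsto_normalizedLength_transposeModule hF hσ hT hsurj hmax hn
  refine ⟨s, Module.finrank (FractionRing R) (FractionRing R ⊗[R] S) * s /
    Module.finrank (ResidueField R) (ResidueField S), (ρ.hasFSignature_iff_tendsto hF hn).2 hsR,
    ?_, mul_div_cancel₀ _ hdeg⟩
  rw [(transposeModule hσ hT).hasFSignature_iff_tendsto (frobenius_finite_of_finite hF)
    (hperiod ▸ hn), hperiod]
  simpa only [mul_div_cancel_left₀ _ hdeg] using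
    hsS.div_const (Module.finrank (ResidueField R) (ResidueField S) : ℝ)

end Transpose

/-! ### Saturation and associated primes -/

/-- The kernel of `M → W⁻¹(M / N)`: the elements of `M` that lie in `N` after localization at
`W`. -/
def saturation {R M : Type*} [CommRing R] [AddCommGroup M] [Module R M] (W : Submonoid R)
    (N : Submodule R M) : Submodule R M where
  carrier := {m | ∃ w ∈ W, w • m ∈ N}
  zero_mem' := ⟨1, W.one_mem, by rw [smul_zero]; exact N.zero_mem⟩
  add_mem' := by
    rintro a b ⟨v, hv, hva⟩ ⟨w, hw, hwb⟩
    refine ⟨v * w, W.mul_mem hv hw, ?_⟩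
    rw [smul_add, mul_smul, mul_smul, smul_comm v w a]
    exact N.add_mem (N.smul_mem _ hva) (N.smul_mem _ hwb)
  smul_mem' := by
    rintro c a ⟨w, hw, hwa⟩
    exact ⟨w, hw, by rw [smul_comm]; exact N.smul_mem _ hwa⟩

theorem exists_smul_mem_of_le_saturation {R M : Type*} [CommRing R] [AddCommGroup M] [Module R M]
    {W : Submonoid R} {N N' : Submodule R M} (hN' : N'.FG) (h : N' ≤ saturation W N) :
    ∃ w ∈ W, ∀ m ∈ N', w • m ∈ N := by
  obtain ⟨s, rfl⟩ := hN'
  have hmem : ∀ m ∈ Submodule.span R (s : Set M), ∃ w ∈ W, w • m ∈ N := fun m hm => h hm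
  choose! w hw hwN using hmem
  refine ⟨∏ m ∈ s, w m, W.prod_mem fun m hm => hw m (Submodule.subset_span hm), fun m hm => ?_⟩
  have hle : Submodule.span R s ≤ N.comap (LinearMap.lsmul R M (∏ m ∈ s, w m)) := by
    refine Submodule.span_le.2 fun a ha => ?_
    obtain ⟨b, hb⟩ := Finset.dvd_prod_of_mem w ha
    change (∏ m ∈ s, w m) • a ∈ N
    rw [hb, mul_comm, mul_smul]
    exact N.smul_mem _ (hwN a (Submodule.subset_span ha))
  exact hle hm

theorem localizedModule_mk_eq_zero_iff {R M : Type*} [CommRing R] [AddCommGroup M] [Module R M]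
    {W : Submonoid R} {m : M} {u : W} :
    (LocalizedModule.mk m u : LocalizedModule W M) = 0 ↔ ∃ w : W, w • m = 0 := by
  rw [← LocalizedModule.zero_mk 1, LocalizedModule.mk_eq]
  simp only [one_smul, smul_zero]

theorem mk_mem_localized_iff {R M : Type*} [CommRing R] [AddCommGroup M] [Module R M]
    {W : Submonoid R} {N : Submodule R M} {m : M} {u : W} :
    LocalizedModule.mk m u ∈ N.localized W ↔ m ∈ saturation W N := by
  rw [Submodule.mem_localized']
  simp only [← IsLocalizedModule.mk_eq_mk']
  constructor
  · rintro ⟨n, hn, s, hs⟩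
    obtain ⟨c, hc⟩ := LocalizedModule.mk_eq.1 hs
    refine ⟨(c * s : W), (c * s).2, ?_⟩
    have hsmul : ((c * s : W) : R) • m = c • u • n := by
      rw [hc, Submonoid.smul_def, Submonoid.smul_def, smul_smul, Submonoid.coe_mul]
    rw [hsmul]
    exact N.smul_mem _ (N.smul_mem _ hn)
  · rintro ⟨w, hw, hwm⟩
    exact ⟨w • m, hwm, ⟨w, hw⟩ * u, LocalizedModule.mk_cancel_common_left ⟨w, hw⟩ u m⟩

theorem exists_notMem_mul_pow_mem_of_mem_minimalPrimes {R : Type*} [CommRing R]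
    [IsNoetherianRing R] {I Q : Ideal R} (hQ : Q ∈ I.minimalPrimes) :
    ∃ (k : ℕ) (v : R), v ∉ Q ∧ ∀ c ∈ Q ^ k, v * c ∈ I := by
  classical
  have hprime : Q.IsPrime := hQ.1.1
  have hfin := I.finite_minimalPrimes_of_isNoetherianRing R
  obtain ⟨k, hk⟩ := I.exists_radical_pow_le_of_fg I.radical.fg_of_isNoetherianRing
  obtain ⟨v, hv, hvQ⟩ : ∃ v ∈ (hfin.toFinset.erase Q).inf id, v ∉ Q := by
    refine SetLike.not_le_iff_exists.1 fun hle => ?_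
    obtain ⟨P, hP, hPQ⟩ := hprime.inf_le'.1 hle
    obtain ⟨hne, hmin⟩ := Finset.mem_erase.1 hP
    rw [Set.Finite.mem_toFinset] at hmin
    exact hne (le_antisymm hPQ (hQ.2 hmin.1 hPQ))
  have hvI : ∀ c ∈ Q, v * c ∈ I.radical := fun c hc => by
    rw [← I.sInf_minimalPrimes, Submodule.mem_sInf]
    intro P hP
    rcases eq_or_ne P Q with rfl | hne
    · exact Ideal.mul_mem_left _ _ hc
    · refine Ideal.mul_mem_right _ _ ?_
      exact Finset.inf_le (f := id) (Finset.mem_erase.2 ⟨hne, hfin.mem_toFinset.2 hP⟩) hv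
  have hle : Ideal.span {v} * Q ≤ I.radical := Ideal.span_singleton_mul_le_iff.2 hvI
  refine ⟨k, v ^ k, fun h => hvQ (hprime.mem_of_pow_mem k h), fun c hc => hk ?_⟩
  refine Ideal.pow_right_mono hle k ?_
  rw [mul_pow, Ideal.span_singleton_pow]
  exact Ideal.mul_mem_mul (Ideal.mem_span_singleton_self _) hc

theorem mem_minimalPrimes_of_comap_pow_le {R S : Type*} [CommRing R] [CommRing S] [Algebra R S]
    [Algebra.IsIntegral R S] {A Q : Ideal S} [Q.IsPrime] (hAQ : A ≤ Q) {k : ℕ}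
    (hA : Q.comap (algebraMap R S) ^ k ≤ A.comap (algebraMap R S)) : Q ∈ A.minimalPrimes := by
  refine ⟨⟨‹_›, hAQ⟩, fun P ⟨hP, hAP⟩ hPQ => ?_⟩
  by_contra hQP
  refine (Ideal.IsIntegral.comap_lt_comap (R := R) (lt_of_le_not_ge hPQ hQP)).not_ge ?_
  exact Ideal.IsPrime.le_of_pow_le (n := k) (hA.trans (Ideal.comap_mono hAP))

theorem mem_associatedPrimes_of_mem_associatedPrimes_pi {R M ι : Type*} [CommRing R]
    [IsNoetherianRing R] [AddCommGroup M] [Module R M] [Finite ι] {η : Ideal R}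
    (hη : η ∈ associatedPrimes R (ι → M)) : η ∈ associatedPrimes R M := by
  cases nonempty_fintype ι
  obtain ⟨hprime, m, rfl⟩ := isAssociatedPrime_iff.1 hη
  have hinf : Finset.univ.inf (fun i => (⊥ : Submodule R M).colon {m i}) ≤
      (⊥ : Submodule R (ι → M)).colon {m} := by
    intro r hr
    simp only [Submodule.mem_finsetInf, Finset.mem_univ, true_imp_iff,
      Submodule.mem_colon_singleton, Submodule.mem_bot] at hr ⊢
    exact funext hr
  obtain ⟨i, -, hi⟩ := hprime.inf_le'.1 hinf
  refine isAssociatedPrime_iff.2 ⟨hprime, m i, le_antisymm (fun r hr => ?_) hi⟩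
  rw [Submodule.mem_colon_singleton, Submodule.mem_bot] at hr ⊢
  exact congrFun hr i

theorem comap_mem_associatedPrimes_of_mem {R S M : Type*} [CommRing R] [IsNoetherianRing R]
    [CommRing S] [IsNoetherianRing S] [Algebra R S] [AddCommGroup M] [Module R M] [Module S M]
    [IsScalarTower R S M] {η : Ideal S} (hη : η ∈ associatedPrimes S M) :
    η.comap (algebraMap R S) ∈ associatedPrimes R M := by
  obtain ⟨hprime, m, rfl⟩ := isAssociatedPrime_iff.1 hη
  refine isAssociatedPrime_iff.2 ⟨Ideal.comap_isPrime _ _, m, Ideal.ext fun r => ?_⟩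
  rw [Ideal.mem_comap, Submodule.mem_colon_singleton, Submodule.mem_colon_singleton,
    algebraMap_smul, Submodule.mem_bot, Submodule.mem_bot]

/-! ### Orbits under localization -/

namespace CartierModule

section Orbit

variable {p : ℕ} [Fact p.Prime] {R : Type u} [CommRing R] {C : CartierAlgebra.{u, w} p R}
  {M : Type v} [AddCommGroup M] [Module R M] {ρ : CartierModule C M}

theorem PlusOrbit.smul {h : ℕ} {m m' : M} (H : ρ.PlusOrbit h m m') (v : R) :
    ρ.PlusOrbit h (v • m) (v • m') := by
  induction H with
  | zero => exact .zero _
  | @succ _ _ m' e he x _ ih =>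
    have hact : v • ρ.act e x m' = ρ.act e (v ^ (p ^ e - 1) • x) (v • m') := by
      rw [ρ.act_right, smul_smul, pow_sub_one_mul (pow_ne_zero e (Fact.out : p.Prime).ne_zero),
        ρ.isCartierLinear]
    rw [hact]
    exact .succ he _ ih

theorem PlusOrbit.smul_eq_zero {h : ℕ} {m m' : M} (H : ρ.PlusOrbit h m m') {I : Ideal R}
    (hI : ∀ c ∈ I, c • m = 0) : ∀ c ∈ I, c • m' = 0 := by
  induction H with
  | zero => exact hI
  | @succ _ _ m' e _ x _ ih =>
    intro c hc
    rw [← ρ.isCartierLinear, ih hI _ (Ideal.pow_mem_of_mem _ hc _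
      (Nat.pos_of_ne_zero (pow_ne_zero e (Fact.out : p.Prime).ne_zero))), map_zero]

end Orbit

section NilAt

variable {p : ℕ} {R : Type u} [CommRing R] {C : CartierAlgebra.{u, w} p R}
  {M : Type v} [AddCommGroup M] [Module R M] {ρ : CartierModule C M}

variable (ρ) in
/-- Every element of `M` killed by a power of `η` has all its orbits of length `h` in `N`, locally
at `η`; this is the condition on `N` in the definition of the test module, without localizing. -/
def NilAt (η : Ideal R) (N : Submodule R M) (h : ℕ) : Prop :=
  ∀ m : M, (∃ k : ℕ, ∀ c ∈ η ^ k, c • m = 0) → ∀ m', ρ.PlusOrbit h m m' → ∃ w ∉ η, w • m' ∈ N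

variable [Fact p.Prime]

theorem NilAt.mono {η : Ideal R} {N : Submodule R M} (hN : ρ.IsCartierSubmodule N) {h h' : ℕ}
    (H : ρ.NilAt η N h) (hle : h ≤ h') : ρ.NilAt η N h' := by
  induction hle with
  | refl => exact H
  | step _ ih =>
    rintro m hm _ (_ | @⟨_, _, m', e, he, x, hx⟩)
    obtain ⟨w, hw, hwN⟩ := ih m hm m' hx
    refine ⟨w, hw, ?_⟩
    rw [← ρ.isCartierLinear]
    refine hN e x _ ?_
    rw [← pow_sub_one_mul (pow_ne_zero e (Fact.out : p.Prime).ne_zero), mul_smul]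
    exact N.smul_mem _ hwN

theorem NilAt.exists_smul_mem_of_mem_minimalPrimes [IsNoetherianRing R] {η : Ideal R}
    {N : Submodule R M} {h : ℕ} (H : ρ.NilAt η N h) {m m' : M}
    (hη : η ∈ ((⊥ : Submodule R M).colon {m}).minimalPrimes) (hm' : ρ.PlusOrbit h m m') :
    ∃ w ∉ η, w • m' ∈ N := by
  obtain ⟨k, v, hv, hvk⟩ := exists_notMem_mul_pow_mem_of_mem_minimalPrimes hη
  have hvm : ∀ c ∈ η ^ k, c • v • m = 0 := fun c hc => by
    rw [smul_smul, mul_comm]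
    exact Submodule.mem_colon_singleton.1 (hvk c hc)
  obtain ⟨w, hw, hwN⟩ := H (v • m) ⟨k, hvm⟩ _ (hm'.smul v)
  exact ⟨w * v, fun hmem => (hη.1.1.mem_or_mem hmem).elim hw hv, by rwa [mul_smul]⟩

theorem exists_forall_nilAt [IsNoetherianRing R] [Module.Finite R M] {N : Submodule R M}
    (hN : ρ.IsCartierSubmodule N) (h : ∀ η ∈ associatedPrimes R M, ∃ h, ρ.NilAt η N h) :
    ∃ h, ∀ η ∈ associatedPrimes R M, ρ.NilAt η N h := by
  choose! f hf using h
  have hfin := associatedPrimes.finite R M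
  exact ⟨hfin.toFinset.sup f, fun η hη =>
    (hf η hη).mono hN (Finset.le_sup (f := f) (hfin.mem_toFinset.2 hη))⟩

end NilAt

section Localization

variable {p : ℕ} {R : Type u} [CommRing R] {C : CartierAlgebra.{u, w} p R} (W : Submonoid R)

theorem exists_eq_tmul_mk_one {e : ℕ} (y : C.deg e ⊗[R] Localization W) :
    ∃ (x : C.deg e) (w : W), y = x ⊗ₜ[R] Localization.mk 1 w := by
  induction y using TensorProduct.induction_on with
  | zero => exact ⟨0, 1, by rw [TensorProduct.zero_tmul]⟩
  | tmul x c =>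
    induction c using Localization.induction_on with
    | H c =>
      obtain ⟨r, w⟩ := c
      refine ⟨r • x, w, ?_⟩
      rw [TensorProduct.smul_tmul, Localization.smul_mk, smul_eq_mul, mul_one]
  | add a b ha hb =>
    obtain ⟨x, w, rfl⟩ := ha
    obtain ⟨x', w', rfl⟩ := hb
    refine ⟨(w' : R) • x + (w : R) • x', w * w', ?_⟩
    rw [TensorProduct.add_tmul, TensorProduct.smul_tmul, TensorProduct.smul_tmul,
      Localization.smul_mk, Localization.smul_mk]
    congr 2
    · rw [Localization.mk_eq_mk_iff, Localization.r_iff_exists]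
      exact ⟨1, by simp only [OneMemClass.coe_one, one_mul, mul_one, Submonoid.coe_mul]; ring⟩
    · rw [Localization.mk_eq_mk_iff, Localization.r_iff_exists]
      exact ⟨1, by simp only [OneMemClass.coe_one, one_mul, mul_one, Submonoid.coe_mul]; ring⟩

variable [Fact p.Prime] [CharP R p] {M : Type v} [AddCommGroup M] [Module R M]
  (ρ : CartierModule C M)

theorem localization_act_mk {e : ℕ} (x : C.deg e) (w : W) (m : M) (u : W) :
    (ρ.localization W).act e (x ⊗ₜ[R] Localization.mk 1 w : C.deg e ⊗[R] Localization W)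
      (LocalizedModule.mk m u) =
      LocalizedModule.mk (ρ.act e (((w * u : W) : R) ^ (p ^ e - 1) • x) m) (w * u) := by
  change ρ.locAct W e (pow_ne_zero e (Fact.out : p.Prime).ne_zero) x
    (Localization.mk 1 w • LocalizedModule.mk m u) = _
  rw [LocalizedModule.mk_smul_mk, one_smul, locAct_mk, ρ.act_right]

theorem exists_plusOrbit_of_localization {h : ℕ} {m : M} {u : W} {z : LocalizedModule W M}
    (H : (ρ.localization W).PlusOrbit h (LocalizedModule.mk m u) z) :
    ∃ (m' : M) (u' : W), ρ.PlusOrbit h m m' ∧ z = LocalizedModule.mk m' u' := by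
  generalize hy : LocalizedModule.mk m u = y at H
  induction H with
  | zero => exact ⟨m, u, .zero m, hy.symm⟩
  | succ he x _ ih =>
    obtain ⟨m', u', hm', rfl⟩ := ih hy
    obtain ⟨x, w, rfl⟩ := exists_eq_tmul_mk_one W x
    exact ⟨_, _, .succ he _ hm', ρ.localization_act_mk W x w m' u'⟩

variable {ρ} in
theorem PlusOrbit.localization {h : ℕ} {m m' : M} (H : ρ.PlusOrbit h m m') :
    (ρ.localization W).PlusOrbit h (LocalizedModule.mk m 1) (LocalizedModule.mk m' 1) := by
  induction H with
  | zero => exact .zero _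
  | @succ _ _ m' e he x _ ih =>
    have hact := ρ.localization_act_mk W x 1 m' 1
    rw [one_mul, OneMemClass.coe_one, one_pow, one_smul] at hact
    rw [← hact]
    exact .succ he _ ih

end Localization

/-! ### Test modules -/

section Test

variable {R : Type u} [CommRing R] {M : Type v} [AddCommGroup M] [Module R M]

theorem mem_localH0_iff {η : Ideal R} [η.IsPrime] {y : LocalizedModule η.primeCompl M} :
    y ∈ localH0 M η ↔ ∃ k : ℕ, ∀ c ∈ η ^ k, c • y = 0 := by
  refine exists_congr fun k => ?_
  rw [← Localization.AtPrime.map_eq_maximalIdeal, ← Ideal.map_pow]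
  refine ⟨fun h c hc => ?_, fun h c hc => ?_⟩
  · rw [← algebraMap_smul (Localization η.primeCompl)]
    exact h _ (Ideal.mem_map_of_mem _ hc)
  · have hle : (η ^ k).map (algebraMap R (Localization η.primeCompl)) ≤
        LinearMap.ker (LinearMap.toSpanSingleton (Localization η.primeCompl) _ y) := by
      rw [Ideal.map_le_iff_le_comap]
      intro r hr
      rw [Ideal.mem_comap, LinearMap.mem_ker, LinearMap.toSpanSingleton_apply, algebraMap_smul]
      exact h r hr
    exact hle hc

theorem exists_smul_of_mk_mem_localH0 [IsNoetherianRing R] {η : Ideal R} [η.IsPrime] {m : M}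
    {u : η.primeCompl} (h : LocalizedModule.mk m u ∈ localH0 M η) :
    ∃ v ∉ η, ∃ k : ℕ, ∀ c ∈ η ^ k, c • v • m = 0 := by
  obtain ⟨k, hk⟩ := mem_localH0_iff.1 h
  have hle : η ^ k ≤ saturation η.primeCompl
      (LinearMap.ker (LinearMap.toSpanSingleton R M m)) := fun c hc => by
    have hzero := hk c hc
    rw [LocalizedModule.smul'_mk, localizedModule_mk_eq_zero_iff] at hzero
    obtain ⟨v, hv⟩ := hzero
    refine ⟨v, v.2, ?_⟩
    rw [LinearMap.mem_ker, LinearMap.toSpanSingleton_apply, smul_eq_mul, mul_smul]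
    exact hv
  obtain ⟨v, hv, hvk⟩ := exists_smul_mem_of_le_saturation (IsNoetherian.noetherian (η ^ k)) hle
  refine ⟨v, hv, k, fun c hc => ?_⟩
  have hzero := hvk c hc
  rwa [LinearMap.mem_ker, LinearMap.toSpanSingleton_apply, smul_eq_mul, mul_comm,
    mul_smul] at hzero

variable {p : ℕ} [Fact p.Prime] [CharP R p] {C : CartierAlgebra.{u, w} p R}
  (ρ : CartierModule C M)

theorem isFRegular_iff : ρ.IsFRegular ↔ ∀ N, ρ.IsTestSubmodule N → N = ⊤ :=
  sInf_eq_top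

variable [IsNoetherianRing R]

theorem nilInto_iff {η : Ideal R} [η.IsPrime] {N : Submodule R M} :
    (ρ.localization η.primeCompl).NilInto (localH0 M η)
        ((N.localized η.primeCompl : Set (LocalizedModule η.primeCompl M)) ∩ localH0 M η) ↔
      ∃ h, ρ.NilAt η N h := by
  refine exists_congr fun h => ⟨fun H m ⟨k, hk⟩ m' hm' => ?_, fun H y hy z hz => ?_⟩
  · have hm : (LocalizedModule.mk m 1 : LocalizedModule η.primeCompl M) ∈ localH0 M η :=
      mem_localH0_iff.2 ⟨k, fun c hc => by
        rw [LocalizedModule.smul'_mk, hk c hc, LocalizedModule.zero_mk]⟩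
    exact mk_mem_localized_iff.1 (H _ hm _ (hm'.localization η.primeCompl)).1
  · induction y using LocalizedModule.induction_on with
    | h m u =>
      obtain ⟨v, hv, k, hk⟩ := exists_smul_of_mk_mem_localH0 hy
      obtain ⟨m', u', hm', rfl⟩ := ρ.exists_plusOrbit_of_localization _ hz
      obtain ⟨w, hw, hwN⟩ := H (v • m) ⟨k, hk⟩ _ (hm'.smul v)
      constructor
      · exact mk_mem_localized_iff.2
          ⟨w * v, η.primeCompl.mul_mem hw hv, by rwa [mul_smul]⟩
      · refine mem_localH0_iff.2 ⟨k, fun c hc => ?_⟩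
        rw [LocalizedModule.smul'_mk, localizedModule_mk_eq_zero_iff]
        refine ⟨⟨v, hv⟩, ?_⟩
        rw [Submonoid.smul_def, smul_comm]
        exact (hm'.smul v).smul_eq_zero hk c hc

theorem isTestSubmodule_iff {N : Submodule R M} :
    ρ.IsTestSubmodule N ↔ ρ.IsCartierSubmodule N ∧
      ∀ η ∈ associatedPrimes R M, ∃ h, ρ.NilAt η N h :=
  and_congr_right fun _ => ⟨fun H η hη =>
    have := hη.isPrime
    ρ.nilInto_iff.1 (H η hη), fun H η _ hη => ρ.nilInto_iff.2 (H η hη)⟩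

end Test

end CartierModule

/-! ### `F`-regularity and transposition -/

section TraceColon

variable {R : Type u} [CommRing R] {S : Type v} [CommRing S] [Algebra R S]
  {σ : S →ₗ[S] UpperShriek R S R}

theorem apply_one_algebraMap_mul (r : R) (s : S) : σ 1 (algebraMap R S r * s) = r * σ 1 s := by
  rw [← Algebra.smul_def, map_smul, smul_eq_mul]

theorem comap_mem_associatedPrimes_of_injective [IsNoetherianRing R] [Module.Finite R S]
    (hσ : Function.Injective σ) {η : Ideal S} (hη : η ∈ associatedPrimes S S) :
    η.comap (algebraMap R S) ∈ associatedPrimes R R := by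
  have : IsNoetherianRing S := IsNoetherianRing.of_finite R S
  obtain ⟨n, g, hg⟩ := Module.Finite.exists_fin (R := R) (M := S)
  have hinj : Function.Injective (LinearMap.pi fun i => (mulForm σ).flip (g i)) :=
    fun s s' h => mulForm_injective hσ <| LinearMap.ext_on_range hg fun i => congrFun h i
  exact mem_associatedPrimes_of_mem_associatedPrimes_pi
    (associatedPrimes.subset_of_injective hinj (comap_mem_associatedPrimes_of_mem hη))

variable (σ) in
/-- The largest ideal of `S` that `T = σ(1)` maps into `N`. It carries test submodules of `R` to
test submodules of `S`. -/
def traceColon (N : Ideal R) : Ideal S where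
  carrier := {s | ∀ t, σ 1 (s * t) ∈ N}
  zero_mem' t := by rw [zero_mul, map_zero]; exact N.zero_mem
  add_mem' ha hb t := by rw [add_mul, map_add]; exact N.add_mem (ha t) (hb t)
  smul_mem' c s hs t := by
    rw [smul_eq_mul, mul_comm c, mul_assoc]
    exact hs _

theorem traceColon_eq_top_iff (hsurj : Function.Surjective (σ 1)) {N : Ideal R} :
    traceColon σ N = ⊤ ↔ N = ⊤ := by
  rw [Ideal.eq_top_iff_one, Submodule.eq_top_iff']
  refine ⟨fun h r => ?_, fun h t => h _⟩
  obtain ⟨t, rfl⟩ := hsurj r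
  exact one_mul t ▸ h t

theorem exists_smul_mem_traceColon [IsNoetherianRing R] {W : Submonoid R}
    {N : Ideal R} {s : S} (h : ∀ t, σ 1 (s * t) ∈ saturation W N) :
    ∃ w ∈ W, algebraMap R S w * s ∈ traceColon σ N := by
  obtain ⟨w, hw, hwN⟩ := exists_smul_mem_of_le_saturation
    (N' := LinearMap.range (mulForm σ s)) (IsNoetherian.noetherian _) (by
      rintro _ ⟨t, rfl⟩
      exact h t)
  refine ⟨w, hw, fun t => ?_⟩
  rw [mul_assoc, apply_one_algebraMap_mul]
  exact hwN _ ⟨t, rfl⟩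

variable (σ) in
/-- The image of the ideal `N` under `T = σ(1)`. It carries test submodules of `S` to test
submodules of `R`. -/
def traceMap (N : Ideal S) : Ideal R :=
  (N.restrictScalars R).map (σ 1 : S →ₗ[R] R)

theorem eq_top_of_traceMap_eq_top [IsLocalRing R] [IsLocalRing S]
    (hmax : ∀ s ∈ maximalIdeal S, σ 1 s ∈ maximalIdeal R) {N : Ideal S}
    (h : traceMap σ N = ⊤) : N = ⊤ := by
  by_contra hne
  refine (maximalIdeal.isMaximal R).ne_top (top_le_iff.1 (h ▸ ?_))
  rintro _ ⟨s, hs, rfl⟩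
  exact hmax s (le_maximalIdeal hne hs)

end TraceColon

section TransposeModule

variable {p : ℕ} [Fact p.Prime] {R : Type u} [CommRing R] [CharP R p]
  {S : Type v} [CommRing S] [Algebra R S]
  {C : CartierAlgebra.{u, w} p R} {ρ : CartierModule C R} {σ : S →ₗ[S] UpperShriek R S R}

theorem isCartierSubmodule_traceColon (hσ : Function.Injective σ) (hT : IsTransposable σ ρ)
    {N : Ideal R} (hN : ρ.IsCartierSubmodule N) :
    (transposeModule hσ hT).IsCartierSubmodule (traceColon σ N) := by
  intro e y m hm
  refine transposeModule_act_mem hσ hT (H := (traceColon σ N).toAddSubgroup) (fun x s t => ?_) y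
  rw [apply_one_transpose_mul, mul_comm s, mul_assoc]
  exact hN e x _ (hm _)

theorem isCartierSubmodule_traceMap (hσ : Function.Injective σ) (hT : IsTransposable σ ρ)
    {N : Ideal S} (hN : (transposeModule hσ hT).IsCartierSubmodule N) :
    ρ.IsCartierSubmodule (traceMap σ N) := by
  rintro e x _ ⟨s, hs, rfl⟩
  have hmem := hN e (x ⊗ₜ[R] 1 : C.deg _ ⊗[R] S) s hs
  rw [transposeModule_act_tmul, one_mul] at hmem
  exact ⟨_, hmem, apply_one_transpose hT x s⟩

theorem apply_one_mul_mem_closure_of_plusOrbit (hσ : Function.Injective σ)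
    (hT : IsTransposable σ ρ) {h : ℕ} {s z : S} (H : (transposeModule hσ hT).PlusOrbit h s z) :
    ∀ t, σ 1 (z * t) ∈ AddSubgroup.closure {r | ∃ a, ρ.PlusOrbit h (σ 1 (s * a)) r} := by
  induction H with
  | zero => exact fun t => AddSubgroup.subset_closure ⟨t, .zero _⟩
  | @succ h s z e he y _ ih =>
    intro t
    let T : S →+ R := (σ 1 : S →ₗ[R] R).toAddMonoidHom.comp (AddMonoidHom.mulRight t)
    refine transposeModule_act_mem hσ hT (H := (AddSubgroup.closure
      {r | ∃ a, ρ.PlusOrbit (h + 1) (σ 1 (s * a)) r}).comap T) (fun x a => ?_) y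
    change σ 1 (transpose hT x (a * z) * t) ∈ AddSubgroup.closure
      {r | ∃ a, ρ.PlusOrbit (h + 1) (σ 1 (s * a)) r}
    rw [apply_one_transpose_mul, mul_comm a, mul_assoc]
    have hle : AddSubgroup.closure {r | ∃ a, ρ.PlusOrbit h (σ 1 (s * a)) r} ≤
        (AddSubgroup.closure {r | ∃ a, ρ.PlusOrbit (h + 1) (σ 1 (s * a)) r}).comap
          (ρ.act e x) := by
      refine (AddSubgroup.closure_le _).2 ?_
      rintro r ⟨b, hb⟩
      exact AddSubgroup.subset_closure ⟨b, .succ he x hb⟩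
    exact hle (ih _)

theorem exists_plusOrbit_transposeModule (hσ : Function.Injective σ) (hT : IsTransposable σ ρ)
    {h : ℕ} {s : S} {r : R} (H : ρ.PlusOrbit h (σ 1 s) r) :
    ∃ z, (transposeModule hσ hT).PlusOrbit h s z ∧ σ 1 z = r := by
  generalize hs : σ 1 s = r₀ at H
  induction H with
  | zero => exact ⟨s, .zero _, hs⟩
  | succ he x _ ih =>
    obtain ⟨z, hz, rfl⟩ := ih hs
    refine ⟨_, .succ he (x ⊗ₜ[R] 1 : C.deg _ ⊗[R] S) hz, ?_⟩
    rw [transposeModule_act_tmul, one_mul, apply_one_transpose]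

variable [IsNoetherianRing R]

theorem nilAt_traceColon (hσ : Function.Injective σ) (hT : IsTransposable σ ρ) {N : Ideal R}
    {η : Ideal S} [η.IsPrime] {h : ℕ} (H : ρ.NilAt (η.comap (algebraMap R S)) N h) :
    (transposeModule hσ hT).NilAt η (traceColon σ N) h := by
  intro s ⟨k, hk⟩ z hz
  have hle : AddSubgroup.closure {r | ∃ a, ρ.PlusOrbit h (σ 1 (s * a)) r} ≤
      (saturation (η.comap (algebraMap R S)).primeCompl N).toAddSubgroup := by
    refine (AddSubgroup.closure_le _).2 ?_
    rintro r ⟨a, ha⟩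
    refine H _ ⟨k, fun c hc => ?_⟩ _ ha
    have hzero : algebraMap R S c * s = 0 := hk _ (Ideal.le_comap_pow _ _ hc)
    rw [smul_eq_mul, ← apply_one_algebraMap_mul, ← mul_assoc, hzero, zero_mul, map_zero]
  obtain ⟨w, hw, hwz⟩ := exists_smul_mem_traceColon fun t =>
    hle (apply_one_mul_mem_closure_of_plusOrbit hσ hT hz t)
  exact ⟨algebraMap R S w, hw, hwz⟩

variable [Module.Finite R S]

theorem exists_algebraMap_mul_mem_of_plusOrbit (hσ : Function.Injective σ)
    (hT : IsTransposable σ ρ) {N : Ideal S} {h : ℕ}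
    (H : ∀ Q ∈ associatedPrimes S S, (transposeModule hσ hT).NilAt Q N h) {η : Ideal R}
    [η.IsPrime] {s z : S} {k : ℕ} (hk : ∀ c ∈ η ^ k, algebraMap R S c * s = 0)
    (hz : (transposeModule hσ hT).PlusOrbit h s z) :
    ∃ w ∉ η, algebraMap R S w * z ∈ N := by
  have : IsNoetherianRing S := IsNoetherianRing.of_finite R S
  by_contra! hcon
  -- Otherwise some prime over `η` contains every multiplier of `z` into `N`; it turns out to be
  -- an associated prime of `S`, which contradicts `H`.
  obtain ⟨Q, hJQ, hQ, hQη⟩ := Ideal.exists_ideal_over_prime_of_isIntegral η (N.colon {z})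
    fun w hw => by
      by_contra hwη
      exact hcon w hwη (Submodule.mem_colon_singleton.1 hw)
  have hAQ : (⊥ : Ideal S).colon {s} ≤ Q := fun v hv => hJQ <| by
    rw [Submodule.mem_colon_singleton, hz.smul_eq_zero
      (fun c hc => Submodule.mem_colon_singleton.1 hc) v hv]
    exact N.zero_mem
  have hmin : Q ∈ ((⊥ : Ideal S).colon {s}).minimalPrimes := by
    refine mem_minimalPrimes_of_comap_pow_le (R := R) (k := k) hAQ (hQη ▸ fun c hc => ?_)
    exact Submodule.mem_colon_singleton.2 (hk c hc)
  have hass : Q ∈ associatedPrimes S S :=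
    isAssociatedPrime_iff.2 ⟨hQ, Submodule.exists_eq_colon_of_mem_minimalPrimes hmin⟩
  obtain ⟨w, hw, hwN⟩ := (H Q hass).exists_smul_mem_of_mem_minimalPrimes hmin hz
  exact hw (hJQ (Submodule.mem_colon_singleton.2 hwN))

variable [CharP S p]

theorem isTestSubmodule_traceColon (hσ : Function.Injective σ) (hT : IsTransposable σ ρ)
    {N : Ideal R} (hN : ρ.IsTestSubmodule N) :
    (transposeModule hσ hT).IsTestSubmodule (traceColon σ N) := by
  have : IsNoetherianRing S := IsNoetherianRing.of_finite R S
  rw [CartierModule.isTestSubmodule_iff] at hN ⊢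
  refine ⟨isCartierSubmodule_traceColon hσ hT hN.1, fun η hη => ?_⟩
  have := hη.isPrime
  obtain ⟨h, hh⟩ := hN.2 _ (comap_mem_associatedPrimes_of_injective hσ hη)
  exact ⟨h, nilAt_traceColon hσ hT hh⟩

theorem isFRegular_of_transposeModule (hσ : Function.Injective σ) (hT : IsTransposable σ ρ)
    (hsurj : Function.Surjective (σ 1)) (h : (transposeModule hσ hT).IsFRegular) :
    ρ.IsFRegular := by
  rw [CartierModule.isFRegular_iff] at h ⊢
  exact fun N hN => (traceColon_eq_top_iff hsurj).1 (h _ (isTestSubmodule_traceColon hσ hT hN))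

theorem isTestSubmodule_traceMap (hσ : Function.Injective σ) (hT : IsTransposable σ ρ)
    (hsurj : Function.Surjective (σ 1)) {N : Ideal S}
    (hN : (transposeModule hσ hT).IsTestSubmodule N) : ρ.IsTestSubmodule (traceMap σ N) := by
  have : IsNoetherianRing S := IsNoetherianRing.of_finite R S
  rw [CartierModule.isTestSubmodule_iff] at hN ⊢
  obtain ⟨h, hh⟩ := CartierModule.exists_forall_nilAt hN.1 hN.2
  obtain ⟨s₀, hs₀⟩ := hsurj 1
  refine ⟨isCartierSubmodule_traceMap hσ hT hN.1, fun η hη => ⟨h, fun r ⟨k, hk⟩ r' hr' => ?_⟩⟩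
  have := hη.isPrime
  have hs : σ 1 (algebraMap R S r * s₀) = r := by rw [apply_one_algebraMap_mul, hs₀, mul_one]
  obtain ⟨z, hz, rfl⟩ := exists_plusOrbit_transposeModule hσ hT (hs.symm ▸ hr')
  have hkill : ∀ c ∈ η ^ k, algebraMap R S c * (algebraMap R S r * s₀) = 0 := fun c hc => by
    rw [← mul_assoc, ← map_mul, ← smul_eq_mul c, hk c hc, map_zero, zero_mul]
  obtain ⟨w, hw, hwz⟩ := exists_algebraMap_mul_mem_of_plusOrbit hσ hT hh hkill hz
  exact ⟨w, hw, _, hwz, apply_one_algebraMap_mul w z⟩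

theorem isFRegular_transposeModule [IsLocalRing R] [IsLocalRing S]
    (hσ : Function.Injective σ) (hT : IsTransposable σ ρ) (hsurj : Function.Surjective (σ 1))
    (hmax : ∀ s ∈ maximalIdeal S, σ 1 s ∈ maximalIdeal R) (h : ρ.IsFRegular) :
    (transposeModule hσ hT).IsFRegular := by
  rw [CartierModule.isFRegular_iff] at h ⊢
  exact fun N hN =>
    eq_top_of_traceMap_eq_top hmax (h _ (isTestSubmodule_traceMap hσ hT hsurj hN))

end TransposeModule

end

theorem mainTheorem2_general {p : ℕ} [Fact p.Prime]
    {R : Type u} [CommRing R] [IsLocalRing R] [IsNoetherianRing R] [CharP R p]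
    (hF : (frobenius R p).Finite)
    {S : Type v} [CommRing S] [IsLocalRing S] [CharP S p] [Algebra R S]
    [IsLocalHom (algebraMap R S)] [Module.Finite R S]
    {C : CartierAlgebra.{u, w} p R} {ρ : CartierModule C R}
    {σ : S →ₗ[S] UpperShriek R S R} (hσ : Function.Injective σ)
    (hsurj : Function.Surjective (σ 1))
    (hmax : ∀ s ∈ IsLocalRing.maximalIdeal S, σ 1 s ∈ IsLocalRing.maximalIdeal R)
    (hT : IsTransposable σ ρ) :
    (∃ sR sS : ℝ, ρ.HasFSignature sR ∧ (transposeModule hσ hT).HasFSignature sS ∧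
      (Module.finrank (IsLocalRing.ResidueField R) (IsLocalRing.ResidueField S) : ℝ) * sS =
        (Module.finrank (FractionRing R) (FractionRing R ⊗[R] S) : ℝ) * sR) ∧
    (ρ.IsFRegular ↔ (transposeModule hσ hT).IsFRegular) :=
  ⟨exists_hasFSignature_transposeModule hF hσ hT hsurj hmax,
    isFRegular_transposeModule hσ hT hsurj hmax, isFRegular_of_transposeModule hσ hT hsurj⟩

theorem mainTheorem2 {p : ℕ} [Fact p.Prime]
    {R : Type u} [CommRing R] [IsLocalRing R] [IsNoetherianRing R] [CharP R p]
    (hF : (frobenius R p).Finite)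
    {S : Type v} [CommRing S] [IsLocalRing S] [CharP S p] [Algebra R S]
    [IsLocalHom (algebraMap R S)] [Module.Finite R S] (hRS : Function.Injective (algebraMap R S))
    (hflat : Module.Flat (FractionRing R) (FractionRing R ⊗[R] S))
    (C : CartierAlgebra.{u, w} p R) (ρ : CartierModule C R)
    (σ : S →ₗ[S] UpperShriek R S R) (hσ : Function.Injective σ)
    (hgen : Function.Bijective (LinearMap.lTensor (FractionRing R) (σ.restrictScalars R)))
    (hsurj : Function.Surjective (σ 1))
    (hmax : ∀ s ∈ IsLocalRing.maximalIdeal S, σ 1 s ∈ IsLocalRing.maximalIdeal R)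
    (hT : IsTransposable σ ρ) :
    (∃ sR sS : ℝ, ρ.HasFSignature sR ∧ (transposeModule hσ hT).HasFSignature sS ∧
      (Module.finrank (IsLocalRing.ResidueField R) (IsLocalRing.ResidueField S) : ℝ) * sS =
        (Module.finrank (FractionRing R) (FractionRing R ⊗[R] S) : ℝ) * sR) ∧
    (ρ.IsFRegular ↔ (transposeModule hσ hT).IsFRegular) :=
  mainTheorem2_general hF hσ hsurj hmax hT
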